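/- Let $\{Z_{i,j} : 0\le i<j<\infty\}$ be i.i.d. random variables, uniform on $[0,1]$. Let $(\tau_n)$ be a real sequence with $\tau_n\to\infty$ such that $p_n=\sqrt{\tau_n\log n/n}\to 0$. For each $n$, the random graph $G(n,p_n)$ has nodes $1,\dots,n$ and a link $\{i,j\}$ ($i<j$) whenever $Z_{i,j}\le p_n$; adding a node $0$, linked to the others by the same rule, gives a graph $G_0(n,p_n)$ on $\{0,1,\dots,n\}$. The algorithm ALLCAST distributes $m$ bits $b_1,\dots,b_m$ from the source $0$ to the nodes $1,\dots,n$ of $G_0(n,p_n)$ as follows. (0) Every link not involving node $0$ gets one of its two directions by a fair coin, where, for each $n$, the coins are independent of each other and of the $Z_{i,j}$ (their joint law over different $n$ is arbitrary); links at node $0$ point away from $0$. (1) The source picks $m$ of its neighbours and pushes a different bit to each of them; the recipient of $b_i$ is called its owner $O_i$. All other nodes in $\{1,\dots,n\}$ are relays. (2) Each owner $O_i$ pushes $b_i$ along all links directed away from it, and every node collects the bits that arrive directly from owners. (3) Each node $j\in\{1,\dots,n\}$ pulls every bit that it still misses from a relay $r$ with a link directed $r\to j$ that received this bit directly from its owner,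 using each relay for at most one bit (a complete matching of the missing bits to helper relays). The algorithm succeeds if the source has at least $m$ neighbours and, whichever $m$ of them it picks, every node $1,\dots,n$ can find the matching in step (3), so that each of these nodes ends up with all $m$ bits. Let $\pi_n$ be the maximum of $\sum_T\lambda_T$ over all $\lambda_T\ge 0$, indexed by the spanning trees $T$ of the complete graph on $\{1,\dots,n\}$, subject to $\sum_{T\ni e}\lambda_T\le C_e$ for every link $e$, where $C_e=1$ if $e$ is a link of $G(n,p_n)$ and $C_e=0$ otherwise. Then: (a) for every $\varepsilon>0$, almost surely, for all but finitely many $n$, ALLCAST succeeds in distributing $m=\max\{0,\lceil \tfrac12 np_n(1-\varepsilon)\rceil\}$ bits to each of the nodes $1,\dots,n$; (b) almost surely, $\displaystyle\lim_{n\to\infty}\frac{\pi_n}{np_n}=\frac12$. -/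

import Mathlib

open MeasureTheory ProbabilityTheory Filter Topology

noncomputable section

namespace Allcast

/-- The undirected links `{i, j}` with `0 ≤ i < j < ∞`, written with the smaller end first. -/
abbrev Link : Type := {q : ℕ × ℕ // q.1 < q.2}

/-- The graph on all labels whose link `{i, j}` is present iff its variable is at most `p`. -/
def linkGraph (z : Link → ℝ) (p : ℝ) : SimpleGraph ℕ where
  Adj i j := (∃ h : i < j, z ⟨(i, j), h⟩ ≤ p) ∨ (∃ h : j < i, z ⟨(j, i), h⟩ ≤ p)
  symm := ⟨fun _ _ h => h.symm⟩
  loopless := ⟨fun i h => by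
    rcases h with ⟨h, _⟩ | ⟨h, _⟩ <;> exact lt_irrefl i h⟩

/-- The random graph `G(n, p)` on the `n` nodes `1, …, n`. -/
def gnp (z : Link → ℝ) (p : ℝ) (n : ℕ) : SimpleGraph (Set.Icc 1 n) :=
  (linkGraph z p).induce (Set.Icc 1 n)

/-- `G(n, p)` together with a source node `0` that is linked by the same rule. -/
def gnpWithSource (z : Link → ℝ) (p : ℝ) (n : ℕ) : SimpleGraph (Set.Icc 0 n) :=
  (linkGraph z p).induce (Set.Icc 0 n)

/-- The source node `0`. -/
def sourceNode (n : ℕ) : Set.Icc 0 n := ⟨0, le_refl 0, Nat.zero_le n⟩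

/-- The direction that a family of coins gives to a link: heads points from the smaller to the
larger label, tails the other way. -/
def pointsTo (c : Link → Bool) (i j : ℕ) : Prop :=
  (∃ h : i < j, c ⟨(i, j), h⟩ = true) ∨ (∃ h : j < i, c ⟨(j, i), h⟩ = false)

/-- The link probability `p_n = √(τ_n log n / n)`. -/
def linkProb (τ : ℕ → ℝ) (n : ℕ) : ℝ := Real.sqrt (τ n * Real.log n / n)

/-! ### The tree packing linear programme -/

section Packing

variable {V : Type*} [Fintype V]

/-- The spanning trees of the complete graph on `V`. -/
abbrev SpanningTree (V : Type*) : Type _ := {T : SimpleGraph V // T.IsTree}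

instance : Fintype (SpanningTree V) := Fintype.ofFinite _

/-- Feasibility in the linear programme: nonnegative weights on the spanning trees whose total
over the trees through any link is at most the capacity of that link. -/
def IsPacking (C : Sym2 V → ℝ) (w : SpanningTree V → ℝ) : Prop :=
  (∀ T, 0 ≤ w T) ∧
    ∀ e : Sym2 V, ¬ e.IsDiag →
      (∑ T : SpanningTree V, ({T : SpanningTree V | e ∈ T.1.edgeSet}.indicator w T)) ≤ C e

/-- The maximum value of the linear programme (for at least two nodes and nonnegative capacities the
supremum is a maximum; see `packingValue_isGreatest`). -/
def packingValue (C : Sym2 V → ℝ) : ℝ :=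
  sSup {r | ∃ w : SpanningTree V → ℝ, IsPacking C w ∧ r = ∑ T, w T}

theorem packingValue_isGreatest [Nontrivial V] (C : Sym2 V → ℝ)
    (hC : ∀ e, 0 ≤ C e) :
    IsGreatest {r | ∃ w : SpanningTree V → ℝ, IsPacking C w ∧ r = ∑ T, w T} (packingValue C) := by
  have hcl : IsClosed {w : SpanningTree V → ℝ | IsPacking C w} := by
    simp only [IsPacking, Set.ofPred_and, Set.ofPred_forall]
    refine (isClosed_iInter fun T => isClosed_le continuous_const (continuous_apply T)).inter
      (isClosed_iInter fun e => isClosed_iInter fun _ => isClosed_le ?_ continuous_const)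
    refine continuous_finsetSum _ fun T _ => ?_
    by_cases h : e ∈ T.1.edgeSet
    · simpa [Set.indicator, h] using continuous_apply T
    · simpa [Set.indicator, h] using continuous_const
  have hbd : ∀ w : SpanningTree V → ℝ, IsPacking C w → ∀ T, w T ≤ ∑ e, C e := by
    intro w hw T
    obtain ⟨u⟩ : Nonempty V := inferInstance
    obtain ⟨v, huv⟩ := T.2.1.preconnected.exists_adj_of_nontrivial u
    refine le_trans ?_ (Finset.single_le_sum (f := C) (fun e _ => hC e) (Finset.mem_univ s(u, v)))
    refine le_trans ?_ (hw.2 s(u, v) (by simpa using huv.ne))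
    have := Finset.single_le_sum
      (f := fun T : SpanningTree V => {T : SpanningTree V | s(u, v) ∈ T.1.edgeSet}.indicator w T)
      (fun T _ => Set.indicator_nonneg (fun T _ => hw.1 T) T) (Finset.mem_univ T)
    simpa [Set.indicator, huv] using this
  have hK : IsCompact {w : SpanningTree V → ℝ | IsPacking C w} := by
    refine (isCompact_univ_pi fun _ => isCompact_Icc (a := (0 : ℝ)) (b := ∑ e, C e)).of_isClosed_subset
      hcl fun w hw T _ => ⟨hw.1 T, hbd w hw T⟩
  have himg : {r | ∃ w : SpanningTree V → ℝ, IsPacking C w ∧ r = ∑ T, w T} =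
      (fun w : SpanningTree V → ℝ => ∑ T, w T) '' {w | IsPacking C w} := by
    ext r; simp [eq_comm]
  have hne : {w : SpanningTree V → ℝ | IsPacking C w}.Nonempty :=
    ⟨0, fun _ => le_rfl, fun e _ => by simpa [Set.indicator] using hC e⟩
  rw [packingValue, himg]
  exact (hK.image (by fun_prop)).isGreatest_sSup (hne.image _)

open Classical in
/-- The capacity `1` on the links of a graph and `0` elsewhere. -/
def binaryCapacity (G : SimpleGraph V) (e : Sym2 V) : ℝ := if e ∈ G.edgeSet then 1 else 0

end Packing

/-- `π_n` for `G(n, p)`: the maximum rate at which one node can allcast to all other nodes. -/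
def allcastRate (z : Link → ℝ) (p : ℝ) (n : ℕ) : ℝ := packingValue (binaryCapacity (gnp z p n))

/-! ### The push-pull algorithm

A network is a graph `G` with source `s` and a direction `D` of the links away from `s`. There are
`m` bits, and `owner b` is the node to which the source pushes bit `b`. -/

section Algorithm

variable {V : Type*} (G : SimpleGraph V) (s : V) (D : V → V → Prop) {m : ℕ}

/-- There is a link from `u` to `v` that is directed towards `v`. Links at the source point away
from the source, all others are directed by `D`. -/
def Arc (u v : V) : Prop := G.Adj u v ∧ v ≠ s ∧ (u = s ∨ D u v)

/-- Push step 1: different bits are pushed to different neighbours of the source. -/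
def IsPush (owner : Fin m → V) : Prop := Function.Injective owner ∧ ∀ b, G.Adj s (owner b)

/-- A relay is a node other than the source that owns no bit. -/
def IsRelay (owner : Fin m → V) (v : V) : Prop := v ≠ s ∧ ∀ b, owner b ≠ v

/-- The bits that node `v` has after push step 2 and pull step 1: the one it owns and those that
come directly from their owners over links pointing towards `v`. -/
def HasDirectly (owner : Fin m → V) (v : V) (b : Fin m) : Prop :=
  v = owner b ∨ Arc G s D (owner b) v

/-- Pull step 2 at node `j`: `pull b = some r` means that `j` pulls bit `b` from `r`. Only missing
bits are pulled, each from a relay that has a link pointing towards `j` and that received the bit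
directly from its owner, and each relay accounts for at most one bit. -/
def IsPull (owner : Fin m → V) (j : V) (pull : Fin m → Option V) : Prop :=
  (∀ b r, pull b = some r →
    ¬ HasDirectly G s D owner j b ∧ IsRelay s owner r ∧ Arc G s D r j ∧
      HasDirectly G s D owner r b) ∧
  ∀ b b' r, pull b = some r → pull b' = some r → b = b'

/-- The bits that node `j` has at the end. -/
def HasFinally (owner : Fin m → V) (j : V) (pull : Fin m → Option V) (b : Fin m) : Prop :=
  HasDirectly G s D owner j b ∨ ∃ r, pull b = some r

/-- From the given owners, every node other than the source can pull so that it has all bits at the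
end, that is, it finds a complete matching of its missing bits to helper relays. -/
def AllReceive (owner : Fin m → V) : Prop :=
  ∀ j, j ≠ s → ∃ pull : Fin m → Option V,
    IsPull G s D owner j pull ∧ ∀ b, HasFinally G s D owner j pull b

/-- The algorithm succeeds in distributing `m` bits: the source has `m` neighbours to push the bits
to, and whichever of its neighbours it picks, every node receives all bits. -/
def Succeeds (m : ℕ) : Prop :=
  (∃ owner : Fin m → V, IsPush G s owner) ∧
    ∀ owner : Fin m → V, IsPush G s owner → AllReceive G s D owner

end Algorithm

/-- The algorithm succeeds in distributing `m` bits from the source `0` to each of the nodes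
`1, …, n`, on the graph given by `z` and `p` and with the link directions given by `c`. -/
def AllcastSucceeds (z : Link → ℝ) (c : Link → Bool) (p : ℝ) (n m : ℕ) : Prop :=
  Succeeds (gnpWithSource z p n) (sourceNode n) (fun u v => pointsTo c u v) m

end Allcast

end

/-! Success reduces to an expansion property, by Hall's theorem. For a node `j`, call a node a
helper if it has a link directed to `j` and is not a neighbour of the source. Owners are neighbours
of the source, so helpers are relays for every choice of owners. Matching the missing bits of `j` to
helpers fails only if some set `S` of owners, with `j ∉ S`, has all its out-links into the helpers
ending in a set `T` with `|T| < |S| ≤ m` (`allcastSucceeds_of_expansion`).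

By Hoeffding, `j` has about `np/2` helpers, hence at least `k` of them, with `k` slightly above `m`.
The helper set is a function of the links at `0` and at `j` only, so given that set the links from
`S` to the helpers outside `T` are still independent. They are all absent with probability at most
`(1 - p/2) ^ (|S| (k - m))` (`prob_helpers_blocked`). Since `np² = τ log n` with `τ → ∞`, the factor
`(1 - p/2) ^ (k - m)` beats any power of `n`, and the union bound over `j`, `S`, `T` gives `O(n⁻²)`
(`prob_blocked_le`, `prob_failure_le`). Borel–Cantelli then yields (a), whatever the joint law of
the coins over different `n`.

For (b), a successful run sends each bit over its own links among `1, …, n`. These link sets are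
disjoint, connected and spanning, so `m ≤ π_n` (`le_allcastRate_of_succeeds`). Conversely a spanning
tree has `n - 1` links, so `π_n (n - 1)` is at most the number of links, which concentrates at
`n(n-1)p/2`. Part (b) mentions no coins, so they are adjoined on a product space. -/

namespace Allcast

/-! ### Independence of functions of disjoint sets of coordinates. -/

section Independence

variable {Ω ι : Type*} [MeasurableSpace Ω] {μ : Measure Ω}

/-- Pairing two independent families of independent random variables. -/
theorem iIndepFun_prodMk {β γ : Type*} [MeasurableSpace β] [MeasurableSpace γ]
    {X : ι → Ω → β} {Y : ι → Ω → γ} (hXm : ∀ i, Measurable (X i)) (hYm : ∀ i, Measurable (Y i))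
    (hX : iIndepFun X μ) (hY : iIndepFun Y μ)
    (hXY : IndepFun (fun ω i => X i ω) (fun ω i => Y i ω) μ) :
    iIndepFun (fun i ω => (X i ω, Y i ω)) μ := by
  have := hX.isProbabilityMeasure
  rw [iIndepFun_iff_iIndep]
  let π : ι → Set (Set Ω) := fun i =>
    {s | ∃ A B, MeasurableSet A ∧ MeasurableSet B ∧ s = X i ⁻¹' A ∩ Y i ⁻¹' B}
  refine iIndepSets.iIndep (π := π) (m := fun i => MeasurableSpace.comap
    (fun ω => (X i ω, Y i ω)) inferInstance) (fun i => ?_) (fun i => ?_) (fun i => ?_) ?_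
  · exact ((hXm i).prodMk (hYm i)).comap_le
  · rintro _ ⟨A, B, hA, hB, rfl⟩ _ ⟨A', B', hA', hB', rfl⟩ -
    refine ⟨A ∩ A', B ∩ B', hA.inter hA', hB.inter hB', ?_⟩
    ext ω; simp; tauto
  · rw [← generateFrom_prod, MeasurableSpace.comap_generateFrom]
    congr 1
    ext s
    simp only [π, Set.mem_image, Set.mem_image2, Set.mem_ofPred_eq]
    constructor
    · rintro ⟨_, ⟨A, hA, B, hB, rfl⟩, rfl⟩
      exact ⟨A, B, hA, hB, rfl⟩
    · rintro ⟨A, B, hA, hB, rfl⟩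
      exact ⟨_, ⟨A, hA, B, hB, rfl⟩, rfl⟩
  · rw [iIndepSets_iff]
    intro s f hf
    choose! A B hA hB hf using hf
    have h1 : (⋂ i ∈ s, f i) = (fun ω i => X i ω) ⁻¹' (⋂ i ∈ s, (fun x => x i) ⁻¹' A i) ∩
        (fun ω i => Y i ω) ⁻¹' (⋂ i ∈ s, (fun x => x i) ⁻¹' B i) := by
      ext ω
      simp only [Set.mem_iInter, Set.mem_inter_iff, Set.mem_preimage]
      constructor
      · intro h
        exact ⟨fun i hi => by have := h i hi; rw [hf i hi] at this; exact this.1,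
          fun i hi => by have := h i hi; rw [hf i hi] at this; exact this.2⟩
      · intro h i hi
        rw [hf i hi]
        exact ⟨h.1 i hi, h.2 i hi⟩
    rw [h1, hXY.measure_inter_preimage_eq_mul _ _
      (Finset.measurableSet_biInter _ fun i hi => measurable_pi_apply i (hA i hi))
      (Finset.measurableSet_biInter _ fun i hi => measurable_pi_apply i (hB i hi))]
    have h2 := hX.measure_inter_preimage_eq_mul s (sets := A) hA
    have h3 := hY.measure_inter_preimage_eq_mul s (sets := B) hB
    have h4 : ∀ i ∈ s, μ (f i) = μ (X i ⁻¹' A i) * μ (Y i ⁻¹' B i) := by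
      intro i hi
      rw [hf i hi]
      exact (hXY.comp (measurable_pi_apply i) (measurable_pi_apply i)).measure_inter_preimage_eq_mul
        _ _ (hA i hi) (hB i hi)
    rw [Finset.prod_congr rfl h4, Finset.prod_mul_distrib, ← h2, ← h3]
    congr 2 <;> ext ω <;> simp

/-- Carries independence over to an enlarged probability space, where the coins needed for part (b)
live. -/
theorem iIndepFun_comp_measurePreserving {Ω' ι β : Type*} [MeasurableSpace Ω'] {ν : Measure Ω'}
    [MeasurableSpace β] {X : ι → Ω → β} (hXm : ∀ i, Measurable (X i)) (hX : iIndepFun X μ)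
    {f : Ω' → Ω} (hf : MeasurePreserving f ν μ) : iIndepFun (fun i x => X i (f x)) ν := by
  rw [iIndepFun_iff_measure_inter_preimage_eq_mul]
  intro s A hA
  have h1 : ∀ i ∈ s, MeasurableSet (X i ⁻¹' A i) := fun i hi => hXm i (hA i hi)
  have h2 := hX.measure_inter_preimage_eq_mul s hA
  rw [← hf.measure_preimage (s.measurableSet_biInter h1).nullMeasurableSet, Set.preimage_iInter₂]
    at h2
  refine h2.trans (Finset.prod_congr rfl fun i hi => ?_)
  rw [← hf.measure_preimage (h1 i hi).nullMeasurableSet]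
  rfl

theorem exists_comp_restrict {β δ : Type*} [Nonempty δ] {f : (ι → β) → δ} {E : Finset ι}
    (hf : DependsOn f (E : Set ι)) : ∃ g : (E → β) → δ, f = fun w => g fun i => w i := by
  obtain ⟨g, hg⟩ := dependsOn_iff_exists_comp.1 hf
  exact ⟨g, hg⟩

variable {β : Type*} [Finite β] [MeasurableSpace β] [DiscreteMeasurableSpace β]

/-- Over a finite alphabet every function of finitely many coordinates is measurable, so `DependsOn`
on disjoint finite sets is all that has to be checked. -/
theorem indepFun_of_dependsOn {W : ι → Ω → β} (hW : iIndepFun W μ) (hWm : ∀ i, Measurable (W i))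
    {δ δ' : Type*} [Nonempty δ] [Nonempty δ'] [MeasurableSpace δ] [MeasurableSpace δ']
    {f : (ι → β) → δ} {g : (ι → β) → δ'} {E F : Finset ι} (hf : DependsOn f (E : Set ι))
    (hg : DependsOn g (F : Set ι)) (hEF : Disjoint E F) :
    IndepFun (fun ω => f fun i => W i ω) (fun ω => g fun i => W i ω) μ := by
  obtain ⟨f', rfl⟩ := exists_comp_restrict hf
  obtain ⟨g', rfl⟩ := exists_comp_restrict hg
  exact (hW.indepFun_finset E F hEF hWm).comp (measurable_of_finite f') (measurable_of_finite g')

theorem iIndepFun_of_dependsOn {W : ι → Ω → β} (hW : iIndepFun W μ) (hWm : ∀ i, Measurable (W i))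
    {J δ : Type*} [Nonempty δ] [MeasurableSpace δ]
    {f : J → (ι → β) → δ} {E : J → Finset ι} (hf : ∀ j, DependsOn (f j) (E j : Set ι))
    (hE : ∀ i j, i ≠ j → Disjoint (E i) (E j)) :
    iIndepFun (fun j ω => f j fun i => W i ω) μ := by
  classical
  have := hW.isProbabilityMeasure
  rw [iIndepFun_iff_measure_inter_preimage_eq_mul]
  intro s A hA
  induction s using Finset.induction_on with
  | empty => simp
  | insert a s ha ih =>
    -- The events indexed by `s` are bundled into one `Prop`-valued function of the coordinates in
    -- the union of the `E j`, so that pairwise independence suffices for the induction.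
    have hg : DependsOn (fun w : ι → β => ∀ j ∈ s, f j w ∈ A j) (s.biUnion E : Finset ι) := by
      intro w w' h
      refine propext (forall₂_congr fun j hj => ?_)
      rw [hf j fun i hi => h i (Finset.mem_coe.2 (Finset.mem_biUnion.2 ⟨j, hj, hi⟩))]
    have hd : Disjoint (E a) (s.biUnion E) := by
      rw [Finset.disjoint_biUnion_right]
      exact fun j hj => hE a j fun h => ha (h ▸ hj)
    have hind := (indepFun_of_dependsOn hW hWm (hf a) hg hd).measure_inter_preimage_eq_mul
      (A a) {True} (hA a (Finset.mem_insert_self a s)) (MeasurableSet.of_discrete)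
    rw [Finset.prod_insert ha, ← ih fun i hi => hA i (Finset.mem_insert_of_mem hi)]
    have hs : (fun ω => ∀ j ∈ s, f j (fun i => W i ω) ∈ A j) ⁻¹' {True} =
        ⋂ j ∈ s, (fun ω => f j fun i => W i ω) ⁻¹' A j := by ext ω; simp
    rw [Finset.set_biInter_insert, ← hs]
    exact hind

theorem measurable_of_dependsOn {W : ι → Ω → β} (hWm : ∀ i, Measurable (W i))
    {δ : Type*} [Nonempty δ] [MeasurableSpace δ]
    {f : (ι → β) → δ} {E : Finset ι} (hf : DependsOn f (E : Set ι)) :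
    Measurable fun ω => f fun i => W i ω := by
  obtain ⟨f', rfl⟩ := exists_comp_restrict hf
  exact (measurable_of_finite f').comp (measurable_pi_lambda _ fun i => hWm i)

end Independence

/-! ### Hoeffding bounds for counts of independent events. -/

section Hoeffding

variable {Ω J : Type*} [MeasurableSpace Ω] {μ : Measure Ω} [Fintype J]

theorem hoeffding_upper {B : J → Ω → Bool} (hB : iIndepFun B μ) (hm : ∀ j, Measurable (B j))
    {q : ℝ} (hq : ∀ j, μ.real {ω | B j ω = true} = q) {t : ℝ} (ht : 0 ≤ t) :
    μ.real {ω | Fintype.card J * q + t ≤ (Finset.univ.filter fun j => B j ω = true).card} ≤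
      Real.exp (-(2 * t ^ 2 / Fintype.card J)) := by
  have := hB.isProbabilityMeasure
  let f : Bool → ℝ := fun b => if b then 1 else 0
  have hf : Measurable f := measurable_of_finite f
  have hint : ∀ j, μ[fun ω => f (B j ω)] = q := by
    intro j
    rw [← hq j, ← integral_indicator_one (s := {ω | B j ω = true}) (hm j (measurableSet_singleton true))]
    congr 1; ext ω
    by_cases h : B j ω = true <;> simp [f, h, Set.indicator]
  have h1 : ∀ j, HasSubgaussianMGF (fun ω => f (B j ω) - q) ((‖(1 : ℝ) - 0‖₊ / 2) ^ 2) μ := by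
    intro j
    have := hasSubgaussianMGF_of_mem_Icc (μ := μ) (X := fun ω => f (B j ω)) (a := 0) (b := 1)
      (hf.comp (hm j)).aemeasurable (.of_forall fun ω => by
        by_cases h : B j ω = true <;> simp [f, h])
    rwa [hint j] at this
  have h2 := HasSubgaussianMGF.measure_sum_ge_le_of_iIndepFun (s := Finset.univ)
    (hB.comp (fun _ b => f b - q) fun _ => hf.sub_const q) (fun j _ => h1 j) ht
  refine le_trans (le_of_eq ?_) (h2.trans (le_of_eq ?_))
  · congr 1; ext ω
    simp only [Set.mem_ofPred_eq, Function.comp, Finset.sum_sub_distrib, Finset.sum_const,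
      Finset.card_univ, nsmul_eq_mul]
    rw [le_sub_iff_add_le, add_comm t]
    simp [f, Finset.sum_boole]
  · congr 1
    simp
    -- For empty `J` both exponents are divisions by zero, hence `0`.
    by_cases hJ : (Fintype.card J : ℝ) = 0
    · simp [hJ]
    · field_simp

/-- The upper bound applied to the negated variables, which have parameter `1 - q`. -/
theorem hoeffding_lower {B : J → Ω → Bool} (hB : iIndepFun B μ) (hm : ∀ j, Measurable (B j))
    {q : ℝ} (hq : ∀ j, μ.real {ω | B j ω = true} = q) {t : ℝ} (ht : 0 ≤ t) :
    μ.real {ω | ((Finset.univ.filter fun j => B j ω = true).card : ℝ) ≤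
      Fintype.card J * q - t} ≤ Real.exp (-(2 * t ^ 2 / Fintype.card J)) := by
  have := hB.isProbabilityMeasure
  have h := hoeffding_upper (μ := μ) (B := fun j ω => !(B j ω)) (q := 1 - q)
    (hB.comp (fun _ b => !b) fun _ => measurable_of_finite _)
    (fun j => (measurable_of_finite (fun b : Bool => !b)).comp (hm j)) (fun j => by
      have hc : {ω | (!(B j ω)) = true} = {ω | B j ω = true}ᶜ := by ext ω; simp
      rw [hc, probReal_compl_eq_one_sub (s := {ω | B j ω = true}) (hm j (measurableSet_singleton true)), hq]) ht
  refine le_trans (le_of_eq ?_) h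
  congr 1; ext ω
  have h3 := Finset.card_filter_add_card_filter_not (s := (Finset.univ : Finset J))
    (fun j => B j ω = true)
  have h4 : ((Finset.univ.filter fun j => B j ω = true).card : ℝ) +
    (Finset.univ.filter fun j => ¬ B j ω = true).card = Fintype.card J := by
    rw [← Finset.card_univ (α := J), ← h3]; push_cast; rfl
  simp only [Bool.not_eq_true, Bool.not_eq_eq_eq_not, Bool.not_true, Set.mem_ofPred_eq] at h4 ⊢
  constructor <;> intro h <;> linarith

end Hoeffding

/-! ### Random link states: helper sets, blocking events and degree estimates. -/

section Configuration

/-- The link between two distinct nodes (with a dummy value on the diagonal). -/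
def linkOf (i j : ℕ) : Link :=
  if h : i < j then ⟨(i, j), h⟩ else if h : j < i then ⟨(j, i), h⟩ else ⟨(0, 1), Nat.zero_lt_one⟩

theorem linkOf_of_lt {i j : ℕ} (h : i < j) : linkOf i j = ⟨(i, j), h⟩ := by simp [linkOf, h]

theorem linkOf_of_gt {i j : ℕ} (h : j < i) : linkOf i j = ⟨(j, i), h⟩ := by
  simp [linkOf, h, h.not_gt]

theorem linkOf_inj {i j k l : ℕ} (hij : i ≠ j) (hkl : k ≠ l) (h : linkOf i j = linkOf k l) :
    (i = k ∧ j = l) ∨ (i = l ∧ j = k) := by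
  rcases hij.lt_or_gt with h1 | h1 <;> rcases hkl.lt_or_gt with h2 | h2 <;>
    simp only [linkOf_of_lt, linkOf_of_gt, h1, h2, Subtype.mk.injEq, Prod.mk.injEq] at h <;> tauto

/-- The state of the links: whether a link is present, and its direction. -/
abbrev Config : Type := Link → Bool × Bool

/-- The two nodes are linked. -/
def Linked (w : Config) (i j : ℕ) : Prop := i ≠ j ∧ (w (linkOf i j)).1 = true

/-- There is a link directed from `i` to `j`. -/
def DirLinked (w : Config) (i j : ℕ) : Prop := i ≠ j ∧ w (linkOf i j) = (true, decide (i < j))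

instance (w : Config) (i j : ℕ) : Decidable (Linked w i j) := by unfold Linked; infer_instance

instance (w : Config) (i j : ℕ) : Decidable (DirLinked w i j) := by unfold DirLinked; infer_instance

/-- The neighbours of the source. -/
def sourceNbrs (w : Config) (n : ℕ) : Finset ℕ := (Finset.Icc 1 n).filter (Linked w 0)

/-- The nodes with a link directed towards `j` that are not linked to the source. -/
def helpers (w : Config) (n j : ℕ) : Finset ℕ :=
  (Finset.Icc 1 n).filter fun r => ¬ Linked w 0 r ∧ DirLinked w r j

/-- The pairs `i < j` in `{1, …, n}`. -/
def pairs (n : ℕ) : Finset (ℕ × ℕ) :=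
  (Finset.Icc 1 n ×ˢ Finset.Icc 1 n).filter fun q => q.1 < q.2

/-- The linked pairs. -/
def linkedPairs (w : Config) (n : ℕ) : Finset (ℕ × ℕ) := (pairs n).filter fun q => Linked w q.1 q.2

theorem card_pairs (n : ℕ) : ((pairs n).card : ℝ) = n * (n - 1) / 2 := by
  have h1 : (pairs n).card = ((Finset.Icc 1 n ×ˢ Finset.Icc 1 n).filter fun q => q.2 < q.1).card := by
    refine Finset.card_nbij' Prod.swap Prod.swap ?_ ?_ ?_ ?_ <;> intro q <;> simp [pairs] <;> tauto
  have h2 : (pairs n).card + ((Finset.Icc 1 n ×ˢ Finset.Icc 1 n).filter fun q => q.2 < q.1).card =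
      (Finset.Icc 1 n).offDiag.card := by
    rw [pairs, ← Finset.card_union_of_disjoint]
    · congr 1; ext q
      simp only [Finset.mem_union, Finset.mem_filter, Finset.mem_product, Finset.mem_Icc,
        Finset.mem_offDiag]
      omega
    · rw [Finset.disjoint_filter]
      intro q _ h; omega
  rw [← h1, Finset.offDiag_card, Nat.card_Icc] at h2
  have h3 : (pairs n).card + (pairs n).card + n = n * n := by
    have : n ≤ n * n := Nat.le_mul_self n
    simp at h2; omega
  have h4 : ((pairs n).card : ℝ) + (pairs n).card + n = n * n := by exact_mod_cast h3
  linarith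

theorem card_filter_subtype {α : Type*} (s : Finset α) (P : α → Prop) [DecidablePred P] :
    (Finset.univ.filter fun a : s => P a).card = (s.filter P).card := by
  refine Finset.card_nbij (fun a => a.1) ?_ ?_ ?_
  · intro a; simp
  · intro a _ b _ h; exact Subtype.ext h
  · intro a; simp; tauto

theorem dependsOn_linked (i j : ℕ) : DependsOn (fun w => Linked w i j) ({linkOf i j} : Finset Link) := by
  intro w w' h
  simp only [Linked, h (linkOf i j) (by simp)]

theorem dependsOn_dirLinked (i j : ℕ) :
    DependsOn (fun w => DirLinked w i j) ({linkOf i j} : Finset Link) := by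
  intro w w' h
  simp only [DirLinked, h (linkOf i j) (by simp)]

/-- Only links at `0` and at `j` are read, which leaves every other link fresh once the helper set
is known. -/
theorem dependsOn_helpers (n j : ℕ) : DependsOn (fun w => helpers w n j)
    ((Finset.Icc 1 n).image (linkOf 0) ∪ ((Finset.Icc 1 n).erase j).image (linkOf · j) :
      Finset Link) := by
  intro w w' h
  refine Finset.filter_congr fun r hr => ?_
  have h1 : Linked w 0 r = Linked w' 0 r := dependsOn_linked 0 r fun i hi => h i (by
    simp only [Finset.coe_singleton, Set.mem_singleton_iff] at hi
    subst hi
    exact Finset.mem_union_left _ (Finset.mem_image_of_mem _ hr))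
  rw [h1]
  by_cases hrj : r = j
  · simp [DirLinked, hrj]
  · have h2 : DirLinked w r j = DirLinked w' r j := dependsOn_dirLinked r j fun i hi => h i (by
      simp only [Finset.coe_singleton, Set.mem_singleton_iff] at hi
      subst hi
      exact Finset.mem_union_right _ (Finset.mem_image_of_mem _ (by simp [hrj, hr])))
    rw [h2]

variable {Ω : Type*} [MeasurableSpace Ω] {μ : Measure Ω}

/-- Independent link states: each link is present with probability `p`, with a fair direction. -/
structure IsRandomConfig (μ : Measure Ω) (W : Link → Ω → Bool × Bool) (p : ℝ) : Prop where
  measurable : ∀ q, Measurable (W q)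
  indep : iIndepFun W μ
  prob : ∀ q b, μ.real {ω | W q ω = (true, b)} = p / 2

variable {W : Link → Ω → Bool × Bool} {p : ℝ}

namespace IsRandomConfig

theorem prob_linked (h : IsRandomConfig μ W p) {i j : ℕ} (hij : i ≠ j) :
    μ.real {ω | Linked (W · ω) i j} = p := by
  have := h.indep.isProbabilityMeasure
  have h1 : {ω | Linked (W · ω) i j} =
      {ω | W (linkOf i j) ω = (true, true)} ∪ {ω | W (linkOf i j) ω = (true, false)} := by
    ext ω
    simp only [Linked, Set.mem_ofPred_eq, Set.mem_union]
    rcases W (linkOf i j) ω with ⟨_ | _, _ | _⟩ <;> simp [hij]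
  rw [h1, measureReal_union, h.prob, h.prob]
  · ring
  · rw [Set.disjoint_left]
    intro ω h1 h2
    simp only [Set.mem_ofPred_eq] at h1 h2
    simp [h1] at h2
  · exact h.measurable _ (MeasurableSet.of_discrete (s := {(true, false)}))

theorem prob_dirLinked (h : IsRandomConfig μ W p) {i j : ℕ} (hij : i ≠ j) :
    μ.real {ω | DirLinked (W · ω) i j} = p / 2 := by
  rw [← h.prob (linkOf i j) (decide (i < j))]
  simp [DirLinked, hij]

theorem nonneg (h : IsRandomConfig μ W p) : 0 ≤ p := by
  rw [← h.prob_linked zero_ne_one]; exact measureReal_nonneg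

theorem le_one (h : IsRandomConfig μ W p) : p ≤ 1 := by
  have := h.indep.isProbabilityMeasure
  rw [← h.prob_linked zero_ne_one]; exact measureReal_le_one

theorem measurableSet_of_dependsOn (h : IsRandomConfig μ W p) {f : Config → Prop} {E : Finset Link}
    (hf : DependsOn f (E : Set Link)) : MeasurableSet {ω | f (W · ω)} :=
  measurableSet_setOfPred.2 (measurable_of_dependsOn h.measurable hf)

theorem prob_helper (h : IsRandomConfig μ W p) {r j : ℕ} (hr : r ≠ 0) (hj : j ≠ 0) (hrj : r ≠ j) :
    μ.real {ω | ¬ Linked (W · ω) 0 r ∧ DirLinked (W · ω) r j} = (1 - p) * (p / 2) := by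
  have := h.indep.isProbabilityMeasure
  have hd : Disjoint ({linkOf 0 r} : Finset Link) {linkOf r j} := by
    rw [Finset.disjoint_singleton]
    intro he
    have := linkOf_inj hr.symm hrj he
    omega
  have hi := (indepFun_of_dependsOn h.indep h.measurable (dependsOn_linked 0 r)
    (dependsOn_dirLinked r j) hd).measure_inter_preimage_eq_mul {False} {True}
    MeasurableSet.of_discrete MeasurableSet.of_discrete
  have h1 : {ω | ¬ Linked (W · ω) 0 r ∧ DirLinked (W · ω) r j} =
    (fun ω => Linked (W · ω) 0 r) ⁻¹' {False} ∩ (fun ω => DirLinked (W · ω) r j) ⁻¹' {True} := by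
    ext ω; simp
  have h2 : (fun ω => Linked (W · ω) 0 r) ⁻¹' {False} = {ω | Linked (W · ω) 0 r}ᶜ := by
    ext ω; simp
  have h3 : (fun ω => DirLinked (W · ω) r j) ⁻¹' {True} = {ω | DirLinked (W · ω) r j} := by
    ext ω; simp
  rw [h1, measureReal_def, hi, ENNReal.toReal_mul, ← measureReal_def, ← measureReal_def, h2, h3,
    probReal_compl_eq_one_sub (h.measurableSet_of_dependsOn (dependsOn_linked 0 r)),
    h.prob_linked hr.symm, h.prob_dirLinked hrj]

/-- No link is directed from `S` to the disjoint set `U`. -/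
theorem prob_no_dirLinked (h : IsRandomConfig μ W p) {S U : Finset ℕ} (hSU : Disjoint S U) :
    μ.real {ω | ∀ x ∈ S, ∀ r ∈ U, ¬ DirLinked (W · ω) x r} = (1 - p / 2) ^ (S.card * U.card) := by
  have := h.indep.isProbabilityMeasure
  have hne : ∀ q : ↥(S ×ˢ U), q.1.1 ≠ q.1.2 := fun q hq => by
    have := Finset.mem_product.1 q.2
    exact Finset.disjoint_left.1 hSU this.1 (hq ▸ this.2)
  have hi := iIndepFun_of_dependsOn (J := ↥(S ×ˢ U)) h.indep h.measurable
    (f := fun q w => DirLinked w q.1.1 q.1.2) (fun q => dependsOn_dirLinked q.1.1 q.1.2) (by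
      intro q q' hqq'
      rw [Finset.disjoint_singleton]
      intro he
      have h1 := Finset.mem_product.1 q.2
      have h2 := Finset.mem_product.1 q'.2
      rcases linkOf_inj (hne q) (hne q') he with h3 | h3
      · exact hqq' (Subtype.ext (Prod.ext h3.1 h3.2))
      · exact Finset.disjoint_left.1 hSU h1.1 (h3.1 ▸ h2.2))
  have h4 := hi.measure_inter_preimage_eq_mul Finset.univ (sets := fun _ => {False})
    fun _ _ => MeasurableSet.of_discrete
  have h5 : {ω | ∀ x ∈ S, ∀ r ∈ U, ¬ DirLinked (W · ω) x r} =
      ⋂ q ∈ (Finset.univ : Finset ↥(S ×ˢ U)),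
        (fun ω => DirLinked (W · ω) q.1.1 q.1.2) ⁻¹' {False} := by
    ext ω
    simp only [Set.mem_ofPred_eq, Finset.mem_univ, Set.iInter_true, Set.mem_iInter,
      Set.mem_preimage, Set.mem_singleton_iff, eq_iff_iff, iff_false, Subtype.forall,
      Finset.mem_product, Prod.forall, and_imp]
    tauto
  rw [h5, measureReal_def, h4, ENNReal.toReal_prod, Finset.prod_congr rfl (g := fun _ => 1 - p / 2)]
  · simp
  · intro q _
    have h6 : (fun ω => DirLinked (W · ω) q.1.1 q.1.2) ⁻¹' {False} =
        {ω | DirLinked (W · ω) q.1.1 q.1.2}ᶜ := by ext ω; simp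
    rw [h6, ← measureReal_def, probReal_compl_eq_one_sub
      (h.measurableSet_of_dependsOn (dependsOn_dirLinked _ _)), h.prob_dirLinked (hne q)]

/-- It is unlikely that `j` has many helpers, but those outside of `T` are unreachable from `S`. -/
theorem prob_helpers_blocked (h : IsRandomConfig μ W p) {n j k : ℕ} {S T : Finset ℕ}
    (h0 : 0 ∉ S) (hj : j ∉ S) :
    μ.real {ω | k ≤ (helpers (W · ω) n j).card ∧ Disjoint S (helpers (W · ω) n j) ∧
      ∀ x ∈ S, ∀ r ∈ helpers (W · ω) n j \ T, ¬ DirLinked (W · ω) x r} ≤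
    (1 - p / 2) ^ (S.card * (k - T.card)) := by
  have := h.indep.isProbabilityMeasure
  have hp0 := h.nonneg
  have hp1 := h.le_one
  -- The possible values of the helper set. Conditioning on it is done by summing over these values;
  -- `j` is never its own helper.
  let As := (Finset.Icc 1 n).powerset.filter fun A => k ≤ A.card ∧ Disjoint S A ∧ j ∉ A
  have hsub : {ω | k ≤ (helpers (W · ω) n j).card ∧ Disjoint S (helpers (W · ω) n j) ∧
      ∀ x ∈ S, ∀ r ∈ helpers (W · ω) n j \ T, ¬ DirLinked (W · ω) x r} ⊆
      ⋃ A ∈ As, ({ω | helpers (W · ω) n j = A} ∩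
        {ω | ∀ x ∈ S, ∀ r ∈ A \ T, ¬ DirLinked (W · ω) x r}) := by
    rintro ω ⟨h1, h2, h3⟩
    simp only [Set.mem_iUnion]
    refine ⟨helpers (W · ω) n j, ?_, rfl, h3⟩
    simp only [As, Finset.mem_filter, Finset.mem_powerset]
    exact ⟨Finset.filter_subset _ _, h1, h2, fun hjm => (Finset.mem_filter.1 hjm).2.2.1 rfl⟩
  have hmeas : ∀ A, MeasurableSet {ω | helpers (W · ω) n j = A} := fun A =>
    h.measurableSet_of_dependsOn (f := fun w => helpers w n j = A) fun w w' hw =>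
      congrArg (· = A) (dependsOn_helpers n j hw)
  have hterm : ∀ A ∈ As, μ.real ({ω | helpers (W · ω) n j = A} ∩
      {ω | ∀ x ∈ S, ∀ r ∈ A \ T, ¬ DirLinked (W · ω) x r}) ≤
      μ.real {ω | helpers (W · ω) n j = A} * (1 - p / 2) ^ (S.card * (k - T.card)) := by
    intro A hA
    simp only [As, Finset.mem_filter, Finset.mem_powerset] at hA
    obtain ⟨hAn, hkA, hSA, hjA⟩ := hA
    have hSU : Disjoint S (A \ T) := hSA.mono_right Finset.sdiff_subset
    have hg : DependsOn (fun w : Config => ∀ x ∈ S, ∀ r ∈ A \ T, ¬ DirLinked w x r)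
        ((S ×ˢ (A \ T)).image fun q => linkOf q.1 q.2 : Finset Link) := by
      intro w w' hw
      refine propext (forall₂_congr fun x hx => forall₂_congr fun r hr => not_congr ?_)
      refine iff_of_eq (dependsOn_dirLinked x r fun i hi => hw i ?_)
      simp only [Finset.coe_singleton, Set.mem_singleton_iff] at hi
      subst hi
      exact Finset.mem_image.2 ⟨(x, r), Finset.mem_product.2 ⟨hx, hr⟩, rfl⟩
    -- A link from `S` to `A \ T` has neither end at `0` or `j`, so it is not among the links that
    -- determine the helper set.
    have hd : Disjoint ((Finset.Icc 1 n).image (linkOf 0) ∪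
        ((Finset.Icc 1 n).erase j).image (linkOf · j))
        ((S ×ˢ (A \ T)).image fun q => linkOf q.1 q.2) := by
      rw [Finset.disjoint_right]
      intro q hq hq'
      simp only [Finset.mem_image, Finset.mem_product, Prod.exists] at hq
      obtain ⟨x, r, ⟨hx, hr⟩, rfl⟩ := hq
      have hrA := (Finset.mem_sdiff.1 hr).1
      have hxr : x ≠ r := fun e => Finset.disjoint_left.1 hSA hx (e ▸ hrA)
      have hr0 : r ≠ 0 := by have := Finset.mem_Icc.1 (hAn hrA); omega
      have hx0 : x ≠ 0 := fun e => h0 (e ▸ hx)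
      have hxj : x ≠ j := fun e => hj (e ▸ hx)
      have hrj : r ≠ j := fun e => hjA (e ▸ hrA)
      simp only [Finset.mem_union, Finset.mem_image, Finset.mem_Icc, Finset.mem_erase] at hq'
      rcases hq' with ⟨y, hy, he⟩ | ⟨y, ⟨hyj, hy⟩, he⟩
      · have := linkOf_inj (by omega) hxr he
        omega
      · have := linkOf_inj hyj hxr he
        omega
    have hi := (indepFun_of_dependsOn h.indep h.measurable (dependsOn_helpers n j) hg hd
      ).measure_inter_preimage_eq_mul {A} {True} MeasurableSet.of_discrete
        MeasurableSet.of_discrete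
    have e1 : (fun ω => helpers (W · ω) n j) ⁻¹' {A} = {ω | helpers (W · ω) n j = A} := rfl
    have e2 : (fun ω => ∀ x ∈ S, ∀ r ∈ A \ T, ¬ DirLinked (W · ω) x r) ⁻¹' {True} =
        {ω | ∀ x ∈ S, ∀ r ∈ A \ T, ¬ DirLinked (W · ω) x r} := by ext ω; simp
    rw [e1, e2] at hi
    rw [measureReal_def, hi, ENNReal.toReal_mul, ← measureReal_def, ← measureReal_def,
      h.prob_no_dirLinked hSU]
    refine mul_le_mul_of_nonneg_left (pow_le_pow_of_le_one (by linarith) (by linarith) ?_)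
      measureReal_nonneg
    exact Nat.mul_le_mul_left _ ((Nat.sub_le_sub_right hkA _).trans (Finset.le_card_sdiff _ _))
  -- The events that the helper set equals `A` are disjoint for different `A`.
  have hsum : ∑ A ∈ As, μ.real {ω | helpers (W · ω) n j = A} ≤ 1 := by
    rw [← measureReal_biUnion_finset _ fun A _ => hmeas A]
    · exact measureReal_le_one
    · intro A _ B _ hAB
      rw [Function.onFun, Set.disjoint_left]
      intro ω h1 h2
      exact hAB (h1.symm.trans h2)
  calc _ ≤ _ := measureReal_mono hsub (measure_ne_top _ _)
    _ ≤ _ := measureReal_biUnion_finset_le _ _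
    _ ≤ ∑ A ∈ As, μ.real {ω | helpers (W · ω) n j = A} * (1 - p / 2) ^ (S.card * (k - T.card)) :=
        Finset.sum_le_sum hterm
    _ ≤ 1 * (1 - p / 2) ^ (S.card * (k - T.card)) := by
        rw [← Finset.sum_mul]
        exact mul_le_mul_of_nonneg_right hsum (pow_nonneg (by linarith) _)
    _ = _ := one_mul _

theorem prob_sourceNbrs_le (h : IsRandomConfig μ W p) (n : ℕ) {t : ℝ} (ht : 0 ≤ t) :
    μ.real {ω | ((sourceNbrs (W · ω) n).card : ℝ) ≤ n * p - t} ≤ Real.exp (-(2 * t ^ 2 / n)) := by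
  have hne : ∀ r : Finset.Icc 1 n, 0 ≠ r.1 := fun r => by
    have := Finset.mem_Icc.1 r.2; omega
  have hf : ∀ r : Finset.Icc 1 n, DependsOn (fun w : Config => decide (Linked w 0 r.1))
      ({linkOf 0 r.1} : Finset Link) := fun r w w' hw => by
    have := dependsOn_linked 0 r.1 hw
    simp only at this
    simp only [this]
  have h1 := hoeffding_lower (iIndepFun_of_dependsOn h.indep h.measurable hf (by
      intro r r' hrr
      rw [Finset.disjoint_singleton]
      intro he
      have := linkOf_inj (hne r) (hne r') he
      exact hrr (Subtype.ext (by have := hne r; omega))))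
    (fun r => measurable_of_dependsOn h.measurable (hf r)) (q := p)
    (fun r => by simpa using h.prob_linked (hne r)) ht
  have hc : Fintype.card (Finset.Icc 1 n) = n := by simp
  rw [hc] at h1
  refine le_trans (le_of_eq ?_) h1
  congr 1; ext ω
  rw [Set.mem_ofPred_eq, Set.mem_ofPred_eq, sourceNbrs, ← card_filter_subtype]
  simp

theorem prob_helpers_le (h : IsRandomConfig μ W p) {n j : ℕ} (hj : j ∈ Finset.Icc 1 n) {t : ℝ}
    (ht : 0 ≤ t) :
    μ.real {ω | ((helpers (W · ω) n j).card : ℝ) ≤ ((n - 1 : ℕ) : ℝ) * ((1 - p) * (p / 2)) - t} ≤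
      Real.exp (-(2 * t ^ 2 / (n - 1 : ℕ))) := by
  have hj0 : j ≠ 0 := by have := Finset.mem_Icc.1 hj; omega
  have hne : ∀ r : (Finset.Icc 1 n).erase j, r.1 ≠ 0 ∧ r.1 ≠ j := fun r => by
    have := Finset.mem_erase.1 r.2
    have := Finset.mem_Icc.1 this.2; omega
  have hf : ∀ r : (Finset.Icc 1 n).erase j, DependsOn
      (fun w : Config => decide (¬ Linked w 0 r.1 ∧ DirLinked w r.1 j))
      ({linkOf 0 r.1, linkOf r.1 j} : Finset Link) := fun r w w' hw => by
    have h1 := dependsOn_linked 0 r.1 fun i hi => hw i (Finset.mem_insert.2 (.inl (by simpa using hi)))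
    have h2 := dependsOn_dirLinked r.1 j fun i hi => hw i (Finset.mem_insert.2 (.inr (by simpa using hi)))
    simp only at h1 h2
    simp only [h1, h2]
  have h1 := hoeffding_lower (iIndepFun_of_dependsOn h.indep h.measurable hf (by
      intro r r' hrr
      have hr := hne r
      have hr' := hne r'
      have hrr' : r.1 ≠ r'.1 := fun e => hrr (Subtype.ext e)
      -- The event for `r` reads the two links `0r` and `rj`; these pairs are disjoint for different
      -- `r` because `r` is neither `0` nor `j`.
      simp only [Finset.disjoint_insert_left, Finset.mem_insert, Finset.mem_singleton,
        Finset.disjoint_singleton_left]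
      refine ⟨fun he => ?_, fun he => ?_⟩ <;> rcases he with he | he
      · have := linkOf_inj hr.1.symm hr'.1.symm he; omega
      · have := linkOf_inj hr.1.symm hr'.2 he; omega
      · have := linkOf_inj hr.2 hr'.1.symm he; omega
      · have := linkOf_inj hr.2 hr'.2 he; omega))
    (fun r => measurable_of_dependsOn h.measurable (hf r)) (q := (1 - p) * (p / 2))
    (fun r => by simpa using h.prob_helper (hne r).1 hj0 (hne r).2) ht
  have hc : Fintype.card ((Finset.Icc 1 n).erase j) = n - 1 := by
    rw [Fintype.card_coe, Finset.card_erase_of_mem hj]; simp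
  rw [hc] at h1
  have he : ∀ w : Config, helpers w n j =
      ((Finset.Icc 1 n).erase j).filter fun r => ¬ Linked w 0 r ∧ DirLinked w r j := by
    intro w; ext r
    rw [helpers, Finset.mem_filter, Finset.mem_filter, Finset.mem_erase]
    exact ⟨fun h => ⟨⟨h.2.2.1, h.1⟩, h.2⟩, fun h => ⟨h.1.2, h.2⟩⟩
  refine le_trans (le_of_eq ?_) h1
  congr 1; ext ω
  rw [Set.mem_ofPred_eq, Set.mem_ofPred_eq, he, ← card_filter_subtype]
  simp

theorem prob_le_linkedPairs (h : IsRandomConfig μ W p) (n : ℕ) {t : ℝ} (ht : 0 ≤ t) :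
    μ.real {ω | n * (n - 1) / 2 * p + t ≤ ((linkedPairs (W · ω) n).card : ℝ)} ≤
      Real.exp (-(2 * t ^ 2 / (n * (n - 1) / 2))) := by
  have hlt : ∀ q : pairs n, q.1.1 < q.1.2 := fun q => (Finset.mem_filter.1 q.2).2
  have hf : ∀ q : pairs n, DependsOn (fun w : Config => decide (Linked w q.1.1 q.1.2))
      ({linkOf q.1.1 q.1.2} : Finset Link) := fun q w w' hw => by
    have := dependsOn_linked q.1.1 q.1.2 hw
    simp only at this
    simp only [this]
  have h1 := hoeffding_upper (iIndepFun_of_dependsOn h.indep h.measurable hf (by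
      intro q q' hqq
      rw [Finset.disjoint_singleton]
      intro he
      have h1 := linkOf_inj (hlt q).ne (hlt q').ne he
      have h2 := hlt q
      have h3 := hlt q'
      exact hqq (Subtype.ext (Prod.ext (by omega) (by omega)))))
    (fun q => measurable_of_dependsOn h.measurable (hf q)) (q := p)
    (fun q => by simpa using h.prob_linked (hlt q).ne) ht
  rw [Fintype.card_coe, card_pairs] at h1
  refine le_trans (le_of_eq ?_) h1
  congr 1; ext ω
  rw [Set.mem_ofPred_eq, Set.mem_ofPred_eq, linkedPairs, ← card_filter_subtype]
  simp

end IsRandomConfig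

end Configuration

/-! ### From expansion to success, by Hall's theorem. -/

section Success

/-- The link states given by `z`, `p` and the coins `c`. -/
noncomputable def config (z : Link → ℝ) (c : Link → Bool) (p : ℝ) : Config :=
  fun q => (decide (z q ≤ p), c q)

variable {z : Link → ℝ} {c : Link → Bool} {p : ℝ}

theorem linked_config {i j : ℕ} : Linked (config z c p) i j ↔ (linkGraph z p).Adj i j := by
  rcases lt_trichotomy i j with h | rfl | h
  · simp [Linked, config, linkGraph, linkOf_of_lt, h, h.ne, h.not_gt]
  · simp [Linked]
  · simp [Linked, config, linkGraph, linkOf_of_gt, h, h.ne', h.not_gt]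

theorem dirLinked_config {i j : ℕ} :
    DirLinked (config z c p) i j ↔ (linkGraph z p).Adj i j ∧ pointsTo c i j := by
  rcases lt_trichotomy i j with h | rfl | h
  · simp [DirLinked, config, linkGraph, pointsTo, linkOf_of_lt, h, h.ne, h.not_gt]
  · simp [DirLinked]
  · simp [DirLinked, config, linkGraph, pointsTo, linkOf_of_gt, h, h.ne', h.not_gt]

/-- Hall's theorem for the missing bits of `j`, where bit `b` may use a helper `r` if its owner has
a link directed to `r`. Since `S` ranges over all sets disjoint from the helpers, the hypothesis
covers every choice of owners at once. -/
theorem allcastSucceeds_of_expansion {n m : ℕ} (hm : m ≤ (sourceNbrs (config z c p) n).card)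
    (hexp : ∀ j ∈ Finset.Icc 1 n, ∀ S ⊆ Finset.Icc 1 n, ∀ T ⊆ Finset.Icc 1 n, T.card < S.card →
      S.card ≤ m → j ∉ S → Disjoint S (helpers (config z c p) n j) →
      ∃ x ∈ S, ∃ r ∈ helpers (config z c p) n j \ T, DirLinked (config z c p) x r) :
    AllcastSucceeds z c p n m := by
  classical
  set w := config z c p with hw
  have hnbr : ∀ v, v ∈ sourceNbrs w n → 0 ≤ v ∧ v ≤ n := fun v hv => by
    have := Finset.mem_Icc.1 (Finset.mem_filter.1 hv).1
    omega
  refine ⟨?_, fun owner hpush j hj => ?_⟩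
  · obtain ⟨e⟩ := Function.Embedding.nonempty_of_card_le (α := Fin m) (β := sourceNbrs w n)
      (by simpa using hm)
    refine ⟨fun b => ⟨e b, hnbr _ (e b).2⟩, fun b b' h => ?_, fun b => ?_⟩
    · exact e.injective (Subtype.ext (congrArg (fun x : Set.Icc 0 n => x.1) h))
    · exact linked_config.1 (Finset.mem_filter.1 (e b).2).2
  · set D : Set.Icc 0 n → Set.Icc 0 n → Prop := fun u v => pointsTo c u v with hD
    have hjn : j.1 ∈ Finset.Icc 1 n := by
      have h1 : j.1 ≠ 0 := fun h => hj (Subtype.ext h)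
      have := j.2.2
      exact Finset.mem_Icc.2 ⟨by omega, this⟩
    have harc : ∀ u v : Set.Icc 0 n, v.1 ≠ 0 → DirLinked w u v →
        Arc (gnpWithSource z p n) (sourceNode n) D u v := fun u v hv h =>
      ⟨(dirLinked_config.1 h).1, fun e => hv (congrArg Subtype.val e), .inr (dirLinked_config.1 h).2⟩
    have hown : ∀ b, Linked w 0 (owner b) := fun b => linked_config.2 (hpush.2 b)
    have hown0 : ∀ b, (owner b).1 ≠ 0 := fun b => (hown b).1.symm
    have hhelp : ∀ r ∈ helpers w n j, r ∈ Finset.Icc 1 n ∧ ¬ Linked w 0 r ∧ DirLinked w r j :=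
      fun r hr => Finset.mem_filter.1 hr
    let t : {b // ¬ HasDirectly (gnpWithSource z p n) (sourceNode n) D owner j b} → Finset ℕ :=
      fun b => (helpers w n j).filter (DirLinked w (owner b.1))
    have hall : ∀ s : Finset {b // ¬ HasDirectly (gnpWithSource z p n) (sourceNode n) D owner j b},
        s.card ≤ (s.biUnion t).card := by
      intro s
      by_contra! hlt
      have hcard : (s.image fun b => (owner b.1).1).card = s.card :=
        Finset.card_image_of_injective _ fun b b' h => Subtype.ext (hpush.1 (Subtype.ext h))
      -- A violation of Hall's condition: `S` is the set of owners of the bits in `s`, and `T`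
      -- consists of all helpers reached directly from `S`. Here `j ∉ S` because the bits are
      -- missing at `j`, and `S` avoids the helpers because owners are linked to the source.
      obtain ⟨x, hx, r, hr, hxr⟩ := hexp j hjn (s.image fun b => (owner b.1).1) (by
          intro x hx
          obtain ⟨b, -, rfl⟩ := Finset.mem_image.1 hx
          exact Finset.mem_Icc.2 ⟨Nat.one_le_iff_ne_zero.2 (hown0 b), (owner b.1).2.2⟩)
        (s.biUnion t) (by
          intro r hr
          obtain ⟨b, -, hb⟩ := Finset.mem_biUnion.1 hr
          exact (hhelp r (Finset.mem_filter.1 hb).1).1)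
        (hcard ▸ hlt) (by
          rw [hcard]
          exact (Finset.card_le_univ s).trans ((Fintype.card_subtype_le _).trans (by simp))) (by
          intro hx
          obtain ⟨b, -, hb⟩ := Finset.mem_image.1 hx
          exact b.2 (.inl (Subtype.ext hb.symm))) (by
          rw [Finset.disjoint_left]
          intro x hx hx'
          obtain ⟨b, -, rfl⟩ := Finset.mem_image.1 hx
          exact (hhelp _ hx').2.1 (hown b))
      obtain ⟨b, hb, rfl⟩ := Finset.mem_image.1 hx
      rw [Finset.mem_sdiff] at hr
      exact hr.2 (Finset.mem_biUnion.2 ⟨b, hb, Finset.mem_filter.2 ⟨hr.1, hxr⟩⟩)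
    obtain ⟨f, hfi, hf⟩ := (Finset.all_card_le_biUnion_card_iff_exists_injective t).1 hall
    have hf1 := fun b => hhelp _ (Finset.mem_filter.1 (hf b)).1
    have hf2 := fun b => (Finset.mem_filter.1 (hf b)).2
    have hf0 : ∀ b, f b ≠ 0 := fun b => by have := Finset.mem_Icc.1 (hf1 b).1; omega
    let r : _ → Set.Icc 0 n := fun b => ⟨f b, Nat.zero_le _, (Finset.mem_Icc.1 (hf1 b).1).2⟩
    refine ⟨fun b => if h : HasDirectly (gnpWithSource z p n) (sourceNode n) D owner j b then none
      else some (r ⟨b, h⟩), ⟨fun b v hv => ?_, fun b b' v hv hv' => ?_⟩, fun b => ?_⟩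
    · by_cases h : HasDirectly (gnpWithSource z p n) (sourceNode n) D owner j b
      · simp [h] at hv
      · simp only [h, dite_false, Option.some.injEq] at hv
        subst hv
        refine ⟨h, ⟨fun e => hf0 _ (congrArg Subtype.val e), fun b' e => (hf1 ⟨b, h⟩).2.1 ?_⟩,
          harc _ _ ?_ (hf1 ⟨b, h⟩).2.2, .inr (harc _ _ (hf0 _) (hf2 ⟨b, h⟩))⟩
        · have : (owner b').1 = f ⟨b, h⟩ := congrArg Subtype.val e
          exact this ▸ hown b'
        · have := Finset.mem_Icc.1 hjn; omega
    · by_cases h : HasDirectly (gnpWithSource z p n) (sourceNode n) D owner j b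
      · simp [h] at hv
      by_cases h' : HasDirectly (gnpWithSource z p n) (sourceNode n) D owner j b'
      · simp [h'] at hv'
      simp only [h, h', dite_false, Option.some.injEq] at hv hv'
      exact congrArg Subtype.val (hfi (congrArg Subtype.val (hv.trans hv'.symm)))
    · by_cases h : HasDirectly (gnpWithSource z p n) (sourceNode n) D owner j b
      · exact .inl h
      · exact .inr ⟨_, by simp [h]; rfl⟩

end Success

/-! ### Tree packings: the rate against success and against the number of links. -/

section Trees

variable {V : Type*} [Fintype V]

/-- Edge-disjoint connected spanning subgraphs give a tree packing. -/
theorem le_packingValue [Nontrivial V] (G : SimpleGraph V) {m : ℕ} (H : Fin m → SimpleGraph V)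
    (hconn : ∀ b, (H b).Connected) (hle : ∀ b, H b ≤ G)
    (hdisj : ∀ b b' u v, (H b).Adj u v → (H b').Adj u v → b = b') :
    (m : ℝ) ≤ packingValue (binaryCapacity G) := by
  classical
  choose T hTle hT using fun b => (hconn b).exists_isTree_le
  have hC : ∀ e, 0 ≤ binaryCapacity G e := fun e => by unfold binaryCapacity; split_ifs <;> norm_num
  let tree : Fin m → SpanningTree V := fun b => ⟨T b, hT b⟩
  have hsum : ∀ P : SpanningTree V → Prop, ∑ t, ({t | P t}.indicator
      (fun t => ∑ b, if tree b = t then (1 : ℝ) else 0) t) = (Finset.univ.filter fun b => P (tree b)).card := by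
    intro P
    simp only [Set.indicator, Set.mem_ofPred_eq]
    have : ∀ t, (if P t then ∑ b, (if tree b = t then (1 : ℝ) else 0) else 0) =
        ∑ b, if tree b = t then (if P (tree b) then (1 : ℝ) else 0) else 0 := by
      intro t
      split_ifs with h
      · refine Finset.sum_congr rfl fun b _ => ?_
        split_ifs with h1 h2
        · rfl
        · exact absurd (h1 ▸ h) h2
        · rfl
      · symm
        refine Finset.sum_eq_zero fun b _ => ?_
        split_ifs with h1 h2
        · exact absurd (h1 ▸ h2) h
        · rfl
        · rfl
    simp only [this]
    rw [Finset.sum_comm]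
    simp
  refine (packingValue_isGreatest _ hC).2 ⟨fun t => ∑ b, if tree b = t then 1 else 0,
    ⟨fun t => Finset.sum_nonneg fun b _ => by split_ifs <;> norm_num, fun e _ => ?_⟩, ?_⟩
  · rw [hsum fun t => e ∈ t.1.edgeSet]
    induction e with | _ u v
    by_cases huv : G.Adj u v
    · have h1 : (Finset.univ.filter fun b => s(u, v) ∈ (tree b).1.edgeSet).card ≤ 1 := by
        rw [Finset.card_le_one]
        intro b hb b' hb'
        simp only [Finset.mem_filter, Finset.mem_univ, true_and, SimpleGraph.mem_edgeSet] at hb hb'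
        exact hdisj b b' u v (hTle b hb) (hTle b' hb')
      simpa [binaryCapacity, huv] using h1
    · refine le_of_eq_of_le ?_ (hC _)
      rw [Nat.cast_eq_zero, Finset.card_eq_zero, Finset.filter_eq_empty_iff]
      intro b _ hb
      exact huv (hle b (hTle b hb))
  · have := hsum fun _ => True
    simp only [Set.ofPred_true, Set.indicator_univ] at this
    rw [this]
    simp

/-- Double counting for an optimal packing: each tree has `|V| - 1` edges, and the total load on an
edge is at most its capacity. -/
theorem packingValue_mul_le [Nontrivial V] [DecidableEq V] (G : SimpleGraph V)
    [DecidableRel G.Adj] :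
    packingValue (binaryCapacity G) * (Fintype.card V - 1) ≤ G.edgeFinset.card := by
  classical
  have hC : ∀ e, 0 ≤ binaryCapacity G e := fun e => by unfold binaryCapacity; split_ifs <;> norm_num
  obtain ⟨w, hw, hval⟩ := (packingValue_isGreatest _ hC).1
  have hdeg : ∀ T : SpanningTree V, w T * ((Fintype.card V : ℝ) - 1) =
      ∑ e ∈ Finset.univ.filter (fun e : Sym2 V => ¬ e.IsDiag),
        {T : SpanningTree V | e ∈ T.1.edgeSet}.indicator w T := by
    intro T
    have h1 : ((T.1.edgeFinset.card : ℝ)) = Fintype.card V - 1 := by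
      rw [← T.2.card_edgeFinset]; push_cast; ring
    have h2 : T.1.edgeFinset = (Finset.univ.filter fun e : Sym2 V => ¬ e.IsDiag).filter
        fun e => e ∈ T.1.edgeSet := by
      ext e
      simp only [SimpleGraph.mem_edgeFinset, Finset.mem_filter, Finset.mem_univ, true_and]
      exact ⟨fun h => ⟨T.1.not_isDiag_of_mem_edgeSet h, h⟩, fun h => h.2⟩
    have h3 : ∀ e : Sym2 V, {T : SpanningTree V | e ∈ T.1.edgeSet}.indicator w T =
        if e ∈ T.1.edgeSet then w T else 0 := fun e => by
      by_cases h : e ∈ T.1.edgeSet <;> simp [Set.indicator, h]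
    rw [← h1, h2, Finset.sum_congr rfl fun e _ => h3 e, ← Finset.sum_filter, Finset.sum_const, nsmul_eq_mul, mul_comm]
  calc packingValue (binaryCapacity G) * (Fintype.card V - 1)
      = ∑ T, w T * ((Fintype.card V : ℝ) - 1) := by rw [hval, Finset.sum_mul]
    _ = ∑ e ∈ Finset.univ.filter (fun e : Sym2 V => ¬ e.IsDiag), ∑ T : SpanningTree V,
        {T : SpanningTree V | e ∈ T.1.edgeSet}.indicator w T := by
        rw [Finset.sum_comm]
        exact Finset.sum_congr rfl fun T _ => hdeg T
    _ ≤ ∑ e ∈ Finset.univ.filter (fun e : Sym2 V => ¬ e.IsDiag), binaryCapacity G e :=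
        Finset.sum_le_sum fun e he => hw.2 e (Finset.mem_filter.1 he).2
    _ ≤ ∑ e, binaryCapacity G e :=
        Finset.sum_le_sum_of_subset_of_nonneg (Finset.subset_univ _) fun e _ _ => hC e
    _ = G.edgeFinset.card := by
        have h1 : ∀ e, binaryCapacity G e = if e ∈ G.edgeFinset then 1 else 0 := fun e => by
          by_cases h : e ∈ G.edgeSet <;> simp [binaryCapacity, h]
        rw [Finset.sum_congr rfl fun e _ => h1 e, Finset.sum_boole,
          Finset.filter_mem_eq_inter, Finset.univ_inter]

variable {z : Link → ℝ} {c : Link → Bool} {p : ℝ}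

theorem pointsTo_asymm {i j : ℕ} (h : pointsTo c i j) (h' : pointsTo c j i) : False := by
  rcases h with ⟨h1, h2⟩ | ⟨h1, h2⟩ <;> rcases h' with ⟨h3, h4⟩ | ⟨h3, h4⟩
  · omega
  · simp [h2] at h4
  · simp [h2] at h4
  · omega

/-- For each bit, the links that carry it form a connected spanning subgraph on `1, …, n`: every
node is joined to the owner directly or through one relay. No link carries two bits, because it is
used in one direction only, an owner pushes only its own bit, and a relay serves a given node with
at most one bit. -/
theorem le_allcastRate_of_succeeds {n m : ℕ} (hn : 2 ≤ n) (h : AllcastSucceeds z c p n m) :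
    (m : ℝ) ≤ allcastRate z p n := by
  obtain ⟨⟨owner, hpush⟩, hrec⟩ := h
  have hrec := hrec owner hpush
  let ι : Set.Icc 1 n → Set.Icc 0 n := fun v => ⟨v.1, Nat.zero_le _, v.2.2⟩
  have hι : Function.Injective ι := fun u v e => Subtype.ext (congrArg (fun x => x.1) e)
  have hι0 : ∀ v, ι v ≠ sourceNode n := fun v e => by
    have h1 : v.1 = 0 := congrArg (fun x => x.1) e
    have := v.2.1; omega
  have hlift : ∀ v, v ≠ sourceNode n → ∃ u, ι u = v := fun v hv =>
    ⟨⟨v.1, Nat.one_le_iff_ne_zero.2 fun e => hv (Subtype.ext e), v.2.2⟩, rfl⟩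
  choose pull hpull hfin using fun v => hrec (ι v) (hι0 v)
  set D : Set.Icc 0 n → Set.Icc 0 n → Prop := fun u v => pointsTo c u v
  have : Nontrivial (Set.Icc 1 n) := ⟨⟨1, by simp; omega⟩, ⟨2, by simp; omega⟩, by simp⟩
  -- All links out of the owner are kept, together with the links used to pull `b`; links at the
  -- source are left out.
  let R : Fin m → Set.Icc 1 n → Set.Icc 1 n → Prop := fun b u v =>
    Arc (gnpWithSource z p n) (sourceNode n) D (ι u) (ι v) ∧
      (ι u = owner b ∨ pull v b = some (ι u))
  have hRadj : ∀ b u v, R b u v → (gnp z p n).Adj u v ∧ pointsTo c u v := fun b u v huv =>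
    ⟨huv.1.1, huv.1.2.2.resolve_left (hι0 u)⟩
  have hRdisj : ∀ b b' u v, R b u v → R b' u v → b = b' := by
    rintro b b' u v ⟨-, h1⟩ ⟨-, h2⟩
    rcases h1 with h1 | h1 <;> rcases h2 with h2 | h2
    · exact hpush.1 (h1.symm.trans h2)
    · exact absurd h1.symm (((hpull v).1 _ _ h2).2.1.2 b)
    · exact absurd h2.symm (((hpull v).1 _ _ h1).2.1.2 b')
    · exact (hpull v).2 _ _ _ h1 h2
  let H : Fin m → SimpleGraph (Set.Icc 1 n) := fun b => SimpleGraph.fromRel (R b)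
  refine le_packingValue (gnp z p n) H (fun b => ?_) (fun b u v huv => ?_)
    fun b b' u v huv huv' => ?_
  · obtain ⟨o, ho⟩ := hlift (owner b) (hpush.2 b).ne'
    have hadj : ∀ u v, R b u v → (H b).Adj u v := fun u v huv =>
      (SimpleGraph.fromRel_adj _ _ _).2 ⟨(hRadj b u v huv).1.ne, .inl huv⟩
    have hdir : ∀ v, HasDirectly (gnpWithSource z p n) (sourceNode n) D owner (ι v) b →
        (H b).Reachable o v := by
      rintro v (hv | hv)
      · rw [hι (ho.trans hv.symm)]
      · exact (hadj o v ⟨ho ▸ hv, .inl ho⟩).reachable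
    rw [SimpleGraph.connected_iff_exists_forall_reachable]
    refine ⟨o, fun v => ?_⟩
    rcases hfin v b with hv | ⟨r, hr⟩
    · exact hdir v hv
    · obtain ⟨-, hrelay, harc, hhas⟩ := (hpull v).1 b r hr
      obtain ⟨u, rfl⟩ := hlift r hrelay.1
      exact (hdir u hhas).trans (hadj u v ⟨harc, .inr hr⟩).reachable
  · rcases ((SimpleGraph.fromRel_adj _ _ _).1 huv).2 with h1 | h1
    · exact (hRadj b _ _ h1).1
    · exact (hRadj b _ _ h1).1.symm
  · rcases ((SimpleGraph.fromRel_adj _ _ _).1 huv).2 with h1 | h1 <;>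
      rcases ((SimpleGraph.fromRel_adj _ _ _).1 huv').2 with h2 | h2
    · exact hRdisj b b' u v h1 h2
    · exact (pointsTo_asymm (hRadj b _ _ h1).2 (hRadj b' _ _ h2).2).elim
    · exact (pointsTo_asymm (hRadj b _ _ h1).2 (hRadj b' _ _ h2).2).elim
    · exact hRdisj b b' v u h1 h2

theorem allcastRate_mul_le {n : ℕ} (hn : 2 ≤ n) :
    allcastRate z p n * (n - 1) ≤ (linkedPairs (config z c p) n).card := by
  classical
  have : Nontrivial (Set.Icc 1 n) := ⟨⟨1, by simp; omega⟩, ⟨2, by simp; omega⟩, by simp⟩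
  have h1 := packingValue_mul_le (gnp z p n)
  have h2 : Fintype.card (Set.Icc 1 n) = n := by simp
  rw [h2] at h1
  refine h1.trans (Nat.cast_le.2 ?_)
  refine Finset.card_le_card_of_surjOn (fun q : ℕ × ℕ =>
    if h : q.1 ∈ Set.Icc 1 n ∧ q.2 ∈ Set.Icc 1 n then s(⟨q.1, h.1⟩, ⟨q.2, h.2⟩)
      else s(⟨1, by simp; omega⟩, ⟨1, by simp; omega⟩)) ?_
  intro e he
  induction e with | _ u v
  have hadj : (gnp z p n).Adj u v := by simpa using he
  replace hadj : (linkGraph z p).Adj u.1 v.1 := hadj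
  rcases lt_or_gt_of_ne hadj.ne with hlt | hlt
  · refine ⟨(u.1, v.1), ?_, by simp⟩
    simp only [linkedPairs, pairs, Finset.coe_filter, Finset.mem_filter, Finset.mem_product,
      Finset.mem_Icc, Set.mem_ofPred_eq]
    exact ⟨⟨⟨u.2, v.2⟩, hlt⟩, linked_config.2 hadj⟩
  · refine ⟨(v.1, u.1), ?_, by simp [Sym2.eq_swap]⟩
    simp only [linkedPairs, pairs, Finset.coe_filter, Finset.mem_filter, Finset.mem_product,
      Finset.mem_Icc, Set.mem_ofPred_eq]
    exact ⟨⟨⟨v.2, u.2⟩, hlt⟩, linked_config.2 hadj.symm⟩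

end Trees

/-! ### Union bound and failure probability. -/

section Bounds

theorem ae_eventually_notMem_of_le {Ω : Type*} [MeasurableSpace Ω] {μ : Measure Ω}
    [IsFiniteMeasure μ] {s : ℕ → Set Ω} {C : ℝ} (h : ∀ᶠ n : ℕ in atTop, μ.real (s n) ≤ C / n ^ 2) :
    ∀ᵐ ω ∂μ, ∀ᶠ n in atTop, ω ∉ s n := by
  obtain ⟨N, hN⟩ := eventually_atTop.1 h
  have hsum : Summable fun n : ℕ => |C| / (n : ℝ) ^ 2 := by
    simpa [div_eq_mul_inv] using (Real.summable_nat_pow_inv.2 one_lt_two).mul_left |C|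
  -- The terms before `N`, for which no bound is available, are replaced by the empty set.
  have h1 : ∑' n, μ (if N ≤ n then s n else ∅) ≠ ⊤ := by
    refine ne_top_of_le_ne_top hsum.tsum_ofReal_ne_top (ENNReal.tsum_le_tsum fun n => ?_)
    split_ifs with hn
    · rw [← ofReal_measureReal]
      exact ENNReal.ofReal_le_ofReal ((hN n hn).trans (by gcongr; exact le_abs_self C))
    · simp
  filter_upwards [ae_eventually_notMem h1] with ω hω
  filter_upwards [hω, eventually_ge_atTop N] with n hn hNn
  simpa [hNn] using hn

theorem sum_powerset_pow_card (s : Finset ℕ) (u : ℝ) :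
    ∑ S ∈ s.powerset, u ^ S.card = (1 + u) ^ s.card := by
  rw [← Finset.prod_const, Finset.prod_one_add]
  simp

/-- With `x = nu ≤ 1`, `(1 + u) ^ n ≤ exp x ≤ 1 + 2x ≤ 3`, so the product is at most `2x · 3`. -/
theorem one_add_pow_sub_one_mul_le {n : ℕ} {u : ℝ} (hu : 0 ≤ u) (hnu : n * u ≤ 1) :
    ((1 + u) ^ n - 1) * (1 + u) ^ n ≤ 6 * (n * u) := by
  have h0 : 0 ≤ n * u := by positivity
  have h1 : (1 + u) ^ n ≤ Real.exp (n * u) := by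
    rw [Real.exp_nat_mul]
    exact pow_le_pow_left₀ (by linarith) (by linarith [Real.add_one_le_exp u]) n
  have h2 := (abs_le.1 (Real.abs_exp_sub_one_le (x := n * u) (by rwa [abs_of_nonneg h0]))).2
  rw [abs_of_nonneg h0] at h2
  have h3 : 1 ≤ (1 + u) ^ n := one_le_pow₀ (by linarith)
  nlinarith

variable {Ω : Type*} [MeasurableSpace Ω] {μ : Measure Ω} {W : Link → Ω → Bool × Bool} {p : ℝ}

namespace IsRandomConfig

/-- With high probability, no set of at most `m` owners is blocked from the helpers of a node that
has at least `k` helpers. -/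
theorem prob_blocked_le (h : IsRandomConfig μ W p) {n m k : ℕ} {u : ℝ} (hu : 0 ≤ u) (hu1 : u ≤ 1)
    (hnu : n * u ≤ 1) (hk : (1 - p / 2) ^ (k - m) ≤ u ^ 2) :
    μ.real {ω | ∃ j ∈ Finset.Icc 1 n, ∃ S ⊆ Finset.Icc 1 n, ∃ T ⊆ Finset.Icc 1 n,
      T.card < S.card ∧ S.card ≤ m ∧ j ∉ S ∧ k ≤ (helpers (W · ω) n j).card ∧
      Disjoint S (helpers (W · ω) n j) ∧
      ∀ x ∈ S, ∀ r ∈ helpers (W · ω) n j \ T, ¬ DirLinked (W · ω) x r} ≤ 6 * n ^ 2 * u := by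
  classical
  have := h.indep.isProbabilityMeasure
  have hp0 := h.nonneg
  have hp1 := h.le_one
  let I := (Finset.Icc 1 n ×ˢ ((Finset.Icc 1 n).powerset ×ˢ (Finset.Icc 1 n).powerset)).filter
    fun q => q.2.2.card < q.2.1.card ∧ q.2.1.card ≤ m ∧ q.1 ∉ q.2.1
  let B : ℕ × Finset ℕ × Finset ℕ → Set Ω := fun q =>
    {ω | k ≤ (helpers (W · ω) n q.1).card ∧ Disjoint q.2.1 (helpers (W · ω) n q.1) ∧
      ∀ x ∈ q.2.1, ∀ r ∈ helpers (W · ω) n q.1 \ q.2.2, ¬ DirLinked (W · ω) x r}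
  let P := (Finset.Icc 1 n).powerset
  have hterm : ∀ q ∈ I, μ.real (B q) ≤ u ^ q.2.1.card * u ^ q.2.2.card := by
    rintro ⟨j, S, T⟩ hq
    simp only [I, Finset.mem_filter, Finset.mem_product, Finset.mem_powerset] at hq
    obtain ⟨⟨hj, hS, hT⟩, hTS, hSm, hjS⟩ := hq
    refine (h.prob_helpers_blocked (fun h0 => by simpa using hS h0) hjS).trans ?_
    calc (1 - p / 2) ^ (S.card * (k - T.card))
        ≤ (1 - p / 2) ^ ((k - m) * S.card) := by
          refine pow_le_pow_of_le_one (by linarith) (by linarith) ?_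
          rw [mul_comm]
          exact Nat.mul_le_mul_left _ (by omega)
      _ ≤ (u ^ 2) ^ S.card := by
          rw [pow_mul]
          exact pow_le_pow_left₀ (pow_nonneg (by linarith) _) hk _
      -- As `|T| < |S|`, the exponent `2|S|` can pay for both sets; the sum over `S` and `T` then
      -- factorizes.
      _ ≤ u ^ S.card * u ^ T.card := by
          rw [← pow_mul, ← pow_add]
          exact pow_le_pow_of_le_one hu hu1 (by omega)
  calc _ ≤ μ.real (⋃ q ∈ I, B q) := by
        refine measureReal_mono ?_ (measure_ne_top _ _)
        rintro ω ⟨j, hj, S, hS, T, hT, h1, h2, h3, h4⟩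
        simp only [Set.mem_iUnion]
        refine ⟨(j, S, T), ?_, h4⟩
        simp only [I, Finset.mem_filter, Finset.mem_product, Finset.mem_powerset]
        exact ⟨⟨hj, hS, hT⟩, h1, h2, h3⟩
    _ ≤ ∑ q ∈ I, μ.real (B q) := measureReal_biUnion_finset_le _ _
    _ ≤ ∑ q ∈ I, u ^ q.2.1.card * u ^ q.2.2.card := Finset.sum_le_sum hterm
    -- `|T| < |S|` forces `S ≠ ∅`. Dropping the empty set gives the factor `(1 + u) ^ n - 1`, which
    -- is of order `nu`.
    _ ≤ ∑ q ∈ Finset.Icc 1 n ×ˢ (P.erase ∅ ×ˢ P), u ^ q.2.1.card * u ^ q.2.2.card := by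
        refine Finset.sum_le_sum_of_subset_of_nonneg ?_ fun _ _ _ => by positivity
        rintro ⟨j, S, T⟩ hq
        simp only [I, P, Finset.mem_filter, Finset.mem_product, Finset.mem_erase] at hq ⊢
        refine ⟨hq.1.1, ⟨fun e => ?_, hq.1.2.1⟩, hq.1.2.2⟩
        simp [e] at hq
    _ = n * (((1 + u) ^ n - 1) * (1 + u) ^ n) := by
        rw [Finset.sum_product]
        simp only [Finset.sum_product, ← Finset.mul_sum, ← Finset.sum_mul]
        rw [Finset.sum_erase_eq_sub (by simp [P]), sum_powerset_pow_card]
        simp only [Finset.sum_const, nsmul_eq_mul, Nat.card_Icc, add_tsub_cancel_right]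
        simp
        ring
    _ ≤ n * (6 * (n * u)) :=
        mul_le_mul_of_nonneg_left (one_add_pow_sub_one_mul_le hu hnu) (Nat.cast_nonneg n)
    _ = 6 * n ^ 2 * u := by ring

end IsRandomConfig

variable {z : Ω → Link → ℝ} {c : Ω → Link → Bool}

theorem succeeds_and_rate_le_of_typical {z : Link → ℝ} {c : Link → Bool} {n m k : ℕ}
    {η : ℝ} (hn : 2 ≤ n) (hnη : 8 ≤ n * η) (hp0 : 0 ≤ p) (hp : p ≤ η / 8)
    (hk : (k : ℝ) < n * p / 2 * (1 - η / 2) + 1) (hm : m ≤ n * p - n * p / 4)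
    (b1 : ¬ ((sourceNbrs (config z c p) n).card : ℝ) ≤ n * p - n * p / 4)
    (b2 : ∀ j ∈ Finset.Icc 1 n, ¬ ((helpers (config z c p) n j).card : ℝ) ≤
      ((n - 1 : ℕ) : ℝ) * ((1 - p) * (p / 2)) - n * p * η / 8)
    (b3 : ¬ ∃ j ∈ Finset.Icc 1 n, ∃ S ⊆ Finset.Icc 1 n, ∃ T ⊆ Finset.Icc 1 n,
      T.card < S.card ∧ S.card ≤ m ∧ j ∉ S ∧ k ≤ (helpers (config z c p) n j).card ∧
      Disjoint S (helpers (config z c p) n j) ∧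
      ∀ x ∈ S, ∀ r ∈ helpers (config z c p) n j \ T, ¬ DirLinked (config z c p) x r)
    (b4 : ¬ n * (n - 1) / 2 * p + n * (n - 1) / 2 * p * η ≤
      ((linkedPairs (config z c p) n).card : ℝ)) :
    AllcastSucceeds z c p n m ∧ allcastRate z p n ≤ n * p * (1 + η) / 2 := by
  have hn' : (2 : ℝ) ≤ n := by exact_mod_cast hn
  refine ⟨allcastSucceeds_of_expansion ?_ ?_, ?_⟩
  · by_contra! hlt
    refine b1 ?_
    have : ((sourceNbrs (config z c p) n).card : ℝ) ≤ m := by exact_mod_cast hlt.le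
    exact this.trans hm
  · intro j hj S hS T hT hTS hSm hjS hdisj
    by_contra! hno
    refine b3 ⟨j, hj, S, hS, T, hT, hTS, hSm, hjS, ?_, hdisj, hno⟩
    by_contra! hlt
    refine b2 j hj ?_
    have e1 : ((helpers (config z c p) n j).card : ℝ) + 1 ≤ k := by exact_mod_cast hlt
    have e2 : ((n - 1 : ℕ) : ℝ) = n - 1 := by rw [Nat.cast_sub (by omega)]; simp
    rw [e2]
    -- The loss from `n - 1` in place of `n` and the loss from the factor `1 - p` each cost at most
    -- `nη/8`.
    have e3 : (n : ℝ) * (1 - η / 4) ≤ (n - 1) * (1 - p) := by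
      have := mul_le_mul_of_nonneg_left hp (by linarith : (0 : ℝ) ≤ n)
      linarith
    have e4 := mul_le_mul_of_nonneg_right e3 (by linarith : 0 ≤ p / 2)
    linarith
  · have e1 := allcastRate_mul_le (z := z) (c := c) (p := p) hn
    have e3 : allcastRate z p n * (n - 1) ≤ n * p * (1 + η) / 2 * (n - 1) := by
      refine e1.trans ((not_le.1 b4).le.trans (le_of_eq ?_))
      ring
    exact le_of_mul_le_mul_right e3 (by linarith)

-- The four ways to fail are few source neighbours, few helpers of some node, a blocked set, and too
-- many links. Each is controlled by the single quantity `u = exp (-np²η²/32) ≤ n⁻⁴`.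
set_option maxHeartbeats 1000000 in
theorem prob_failure_le (h : IsRandomConfig μ (fun q ω => config (z ω) (c ω) p q) p) {n m : ℕ}
    {η : ℝ} (hη : 0 < η) (hη1 : η ≤ 1) (hn : 2 ≤ n) (hnη : 8 ≤ n * η) (hp : p ≤ η / 8)
    (hnp : 8 ≤ n * p * η) (hlog : 4 * Real.log n ≤ n * p ^ 2 * η ^ 2 / 32)
    (hm : m ≤ n * p * (1 - η) / 2 + 1) :
    μ.real {ω | ¬ (AllcastSucceeds (z ω) (c ω) p n m ∧
      allcastRate (z ω) p n ≤ n * p * (1 + η) / 2)} ≤ 9 / n ^ 2 := by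
  have := h.indep.isProbabilityMeasure
  have hp0 := h.nonneg
  have hn' : (2 : ℝ) ≤ n := by exact_mod_cast hn
  have hnp0 : 8 ≤ n * p := by nlinarith [mul_nonneg (by linarith : (0 : ℝ) ≤ n) hp0]
  have ha : 0 ≤ n * p ^ 2 := by positivity
  set u := Real.exp (-(n * p ^ 2 * η ^ 2 / 32)) with hu
  have hu0 : 0 ≤ u := (Real.exp_pos _).le
  have hηη : η ^ 2 ≤ η := by nlinarith
  have hu4 : u ≤ 1 / (n : ℝ) ^ 4 := by
    calc u ≤ Real.exp (-(4 * Real.log n)) := Real.exp_le_exp.2 (by linarith)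
      _ = 1 / (n : ℝ) ^ 4 := by
        rw [Real.exp_neg, one_div, show (4 : ℝ) = ((4 : ℕ) : ℝ) by norm_num, Real.exp_nat_mul,
          Real.exp_log (by linarith)]
  have hun : (n : ℝ) ^ 2 * u ≤ 1 / (n : ℝ) ^ 2 := by
    calc (n : ℝ) ^ 2 * u ≤ (n : ℝ) ^ 2 * (1 / (n : ℝ) ^ 4) := by gcongr
      _ = 1 / (n : ℝ) ^ 2 := by field_simp
  have hn2 : 1 / (n : ℝ) ^ 2 ≤ 1 := by
    rw [div_le_one (by positivity)]; nlinarith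
  have hnu : n * u ≤ 1 := by nlinarith
  have hu1 : u ≤ 1 := Real.exp_le_one_iff.2 (by
    have : 0 ≤ n * p ^ 2 * η ^ 2 := by positivity
    linarith)
  set W : Link → Ω → Bool × Bool := fun q ω => config (z ω) (c ω) p q with hW
  -- Halfway between the `np(1 - η)/2` bits to be sent and the `np/2` helpers expected to leading
  -- order, so deviations cost a fraction of `η` on either side.
  set k := ⌈n * p / 2 * (1 - η / 2)⌉₊ with hk
  have hk1 : n * p / 2 * (1 - η / 2) ≤ k := Nat.le_ceil _
  have hk2 : (k : ℝ) < n * p / 2 * (1 - η / 2) + 1 := Nat.ceil_lt_add_one (by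
    have : 0 ≤ n * p := by linarith
    nlinarith)
  have hm' : (m : ℝ) ≤ n * p - n * p / 4 := by linarith
  let B1 := {ω | ((sourceNbrs (W · ω) n).card : ℝ) ≤ n * p - n * p / 4}
  let B2 := fun j => {ω | ((helpers (W · ω) n j).card : ℝ) ≤
    ((n - 1 : ℕ) : ℝ) * ((1 - p) * (p / 2)) - n * p * η / 8}
  let B3 := {ω | ∃ j ∈ Finset.Icc 1 n, ∃ S ⊆ Finset.Icc 1 n, ∃ T ⊆ Finset.Icc 1 n,
      T.card < S.card ∧ S.card ≤ m ∧ j ∉ S ∧ k ≤ (helpers (W · ω) n j).card ∧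
      Disjoint S (helpers (W · ω) n j) ∧
      ∀ x ∈ S, ∀ r ∈ helpers (W · ω) n j \ T, ¬ DirLinked (W · ω) x r}
  let B4 := {ω | n * (n - 1) / 2 * p + n * (n - 1) / 2 * p * η ≤
    ((linkedPairs (W · ω) n).card : ℝ)}
  have h1 : μ.real B1 ≤ u := (h.prob_sourceNbrs_le n (t := n * p / 4) (by positivity)).trans
    (Real.exp_le_exp.2 (by
      have e : 2 * (n * p / 4) ^ 2 / n = n * p ^ 2 / 8 := by field_simp; ring
      rw [e]
      nlinarith))
  have h2 : ∀ j ∈ Finset.Icc 1 n, μ.real (B2 j) ≤ u := fun j hj =>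
    (h.prob_helpers_le hj (t := n * p * η / 8) (by positivity)).trans
    (Real.exp_le_exp.2 (by
      have e : n * p ^ 2 * η ^ 2 / 32 = 2 * (n * p * η / 8) ^ 2 / n := by field_simp; ring
      rw [e, neg_le_neg_iff]
      have : (1 : ℕ) ≤ n - 1 := by omega
      have : (0 : ℝ) < (n - 1 : ℕ) := by exact_mod_cast this
      gcongr
      omega))
  have h3 : μ.real B3 ≤ 6 * n ^ 2 * u := h.prob_blocked_le hu0 hu1 hnu (by
    -- The gap is at least `npη/4 - 1`, where the `1` comes from rounding up `m`; it is absorbed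
    -- since `npη ≥ 8`.
    have e1 : n * p * η / 8 ≤ ((k - m : ℕ) : ℝ) := by
      have : (k : ℝ) ≤ ((k - m : ℕ) : ℝ) + m := by
        have : k ≤ (k - m) + m := by omega
        exact_mod_cast this
      nlinarith
    have e2 : (1 - p / 2) ^ (k - m) ≤ Real.exp (((k - m : ℕ) : ℝ) * -(p / 2)) := by
      rw [Real.exp_nat_mul]
      exact pow_le_pow_left₀ (by linarith) (by linarith [Real.add_one_le_exp (-(p / 2))]) _
    refine e2.trans ?_
    rw [hu, ← Real.exp_nat_mul]
    refine Real.exp_le_exp.2 ?_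
    push_cast
    have e3 := mul_le_mul_of_nonneg_right e1 (by linarith : 0 ≤ p / 2)
    nlinarith)
  have h4 : μ.real B4 ≤ u := (h.prob_le_linkedPairs n (t := n * (n - 1) / 2 * p * η) (by
      have : (0 : ℝ) ≤ n - 1 := by linarith
      positivity)).trans (Real.exp_le_exp.2 (by
      have hn1 : (n : ℝ) - 1 ≠ 0 := by linarith
      have e : 2 * (n * (n - 1) / 2 * p * η) ^ 2 / (n * (n - 1) / 2) =
          n * p ^ 2 * η ^ 2 * ((n : ℝ) - 1) := by field_simp
      rw [e]
      have : 0 ≤ n * p ^ 2 * η ^ 2 := by positivity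
      nlinarith))
  have hsub : {ω | ¬ (AllcastSucceeds (z ω) (c ω) p n m ∧
      allcastRate (z ω) p n ≤ n * p * (1 + η) / 2)} ⊆
      ((B1 ∪ ⋃ j ∈ Finset.Icc 1 n, B2 j) ∪ B3) ∪ B4 := by
    intro ω hω
    by_contra hB
    simp only [Set.mem_union, Set.mem_iUnion, not_or, not_exists] at hB
    obtain ⟨⟨⟨b1, b2⟩, b3⟩, b4⟩ := hB
    exact hω (succeeds_and_rate_le_of_typical hn hnη hp0 hp hk2 hm' b1 b2 b3 b4)
  calc _ ≤ _ := measureReal_mono hsub (measure_ne_top _ _)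
    _ ≤ ((μ.real B1 + ∑ j ∈ Finset.Icc 1 n, μ.real (B2 j)) + μ.real B3) + μ.real B4 := by
        refine (measureReal_union_le _ _).trans (add_le_add_left ((measureReal_union_le _ _).trans
          (add_le_add_left ((measureReal_union_le _ _).trans
            (add_le_add_right (measureReal_biUnion_finset_le _ _) _)) _)) _)
    _ ≤ ((u + n * u) + 6 * n ^ 2 * u) + u := by
        have := Finset.sum_le_sum h2
        simp only [Finset.sum_const, nsmul_eq_mul, Nat.card_Icc, add_tsub_cancel_right] at this
        linarith
    _ = (2 + n + 6 * n ^ 2) * u := by ring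
    _ ≤ (9 * n ^ 2) * u := by
        gcongr
        nlinarith
    _ ≤ 9 / n ^ 2 := by
        rw [mul_assoc, ← mul_one_div 9]
        exact mul_le_mul_of_nonneg_left hun (by norm_num)

end Bounds

/-! ### Almost sure statements and the limit. -/

section Limit

variable {Ω : Type*} [MeasurableSpace Ω] {μ : Measure Ω} [IsProbabilityMeasure μ]

theorem isRandomConfig_config {Z : Link → Ω → ℝ} (hZm : ∀ q, Measurable (Z q))
    (hZu : ∀ q, pdf.IsUniform (Z q) (Set.Icc 0 1) μ volume) (hZi : iIndepFun Z μ)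
    {coin : Link → Ω → Bool} (hcm : ∀ q, Measurable (coin q))
    (hc : ∀ q, μ {ω | coin q ω = true} = 1 / 2) (hci : iIndepFun coin μ)
    (hZc : IndepFun (fun ω q => Z q ω) (fun ω q => coin q ω) μ) {p : ℝ} (hp0 : 0 ≤ p)
    (hp1 : p ≤ 1) :
    IsRandomConfig μ (fun q ω => config (fun q => Z q ω) (fun q => coin q ω) p q) p := by
  have hd : Measurable fun x : ℝ => decide (x ≤ p) := measurable_to_bool <| by
    have : (fun x : ℝ => decide (x ≤ p)) ⁻¹' {true} = Set.Iic p := by ext; simp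
    rw [this]; exact measurableSet_Iic
  have hdm : ∀ q, Measurable fun ω => decide (Z q ω ≤ p) := fun q => hd.comp (hZm q)
  have hdpi : Measurable fun (x : Link → ℝ) q => decide (x q ≤ p) :=
    measurable_pi_lambda _ fun q => hd.comp (measurable_pi_apply q)
  have hind : IndepFun (fun ω q => decide (Z q ω ≤ p)) (fun ω q => coin q ω) μ :=
    hZc.comp hdpi measurable_id
  refine ⟨fun q => (hdm q).prodMk (hcm q), iIndepFun_prodMk hdm hcm
    (hZi.comp (fun _ x => decide (x ≤ p)) fun _ => hd) hci hind, fun q b => ?_⟩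
  have h1 : {ω | config (fun q => Z q ω) (fun q => coin q ω) p q = (true, b)} =
      (fun ω => decide (Z q ω ≤ p)) ⁻¹' {true} ∩ coin q ⁻¹' {b} := by
    ext ω; simp [config]
  have h2 := (hind.comp (measurable_pi_apply q) (measurable_pi_apply q)).measure_inter_preimage_eq_mul
    {true} {b} MeasurableSet.of_discrete MeasurableSet.of_discrete
  have h3 : (fun ω => decide (Z q ω ≤ p)) ⁻¹' {true} = Z q ⁻¹' Set.Iic p := by ext ω; simp
  have h4 : μ.real (Z q ⁻¹' Set.Iic p) = p := by
    rw [measureReal_def, ← Measure.map_apply (hZm q) measurableSet_Iic, hZu q,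
      ProbabilityTheory.cond_apply measurableSet_Icc]
    have : Set.Icc (0 : ℝ) 1 ∩ Set.Iic p = Set.Icc 0 p := by
      ext x; simp only [Set.mem_inter_iff, Set.mem_Icc, Set.mem_Iic]
      constructor
      · exact fun h => ⟨h.1.1, h.2⟩
      · exact fun h => ⟨⟨h.1, h.2.trans hp1⟩, h.2⟩
    rw [this]
    simp [hp0]
  have h5 : μ.real (coin q ⁻¹' {true}) = 1 / 2 := by
    have : coin q ⁻¹' {true} = {ω | coin q ω = true} := rfl
    rw [measureReal_def, this, hc q]; simp
  have h6 : μ.real (coin q ⁻¹' {b}) = 1 / 2 := by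
    cases b
    · have : coin q ⁻¹' {false} = (coin q ⁻¹' {true})ᶜ := by ext ω; simp
      rw [this, probReal_compl_eq_one_sub (hcm q MeasurableSet.of_discrete), h5]; norm_num
    · exact h5
  have h7 : μ.real ((fun ω => decide (Z q ω ≤ p)) ⁻¹' {true} ∩ coin q ⁻¹' {b}) =
      μ.real ((fun ω => decide (Z q ω ≤ p)) ⁻¹' {true}) * μ.real (coin q ⁻¹' {b}) := by
    rw [measureReal_def, measureReal_def, measureReal_def, ← ENNReal.toReal_mul]
    exact congrArg ENNReal.toReal h2
  rw [h1, h7, h3, h4, h6]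
  ring

variable {τ : ℕ → ℝ}

theorem eventually_linkProb (hτ : Tendsto τ atTop atTop)
    (hp : Tendsto (linkProb τ) atTop (𝓝 0)) {η : ℝ} (hη : 0 < η) :
    ∀ᶠ n : ℕ in atTop, 2 ≤ n ∧ 8 ≤ n * η ∧ linkProb τ n ≤ η / 8 ∧ linkProb τ n ≤ 1 ∧
      8 ≤ n * linkProb τ n * η ∧ 4 * Real.log n ≤ n * linkProb τ n ^ 2 * η ^ 2 / 32 := by
  have hlog : Tendsto (fun n : ℕ => Real.log n) atTop atTop :=
    Real.tendsto_log_atTop.comp tendsto_natCast_atTop_atTop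
  have hnη : Tendsto (fun n : ℕ => (n : ℝ) * η) atTop atTop :=
    tendsto_natCast_atTop_atTop.atTop_mul_const hη
  filter_upwards [eventually_ge_atTop 2, hnη.eventually_ge_atTop 8,
    hp.eventually_le_const (show 0 < η / 8 by positivity), hp.eventually_le_const zero_lt_one,
    hτ.eventually_ge_atTop (128 / η ^ 2), hτ.eventually_ge_atTop (8 / η),
    hlog.eventually_ge_atTop 1] with n h1 h2 h3 h4 h5 h6 h7
  have hn0 : (0 : ℝ) < n := by exact_mod_cast (by omega : 0 < n)
  have hτ0 : 0 < τ n := lt_of_lt_of_le (by positivity) h6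
  -- The choice of `p_n` enters here: `np²` exceeds `log n` by the factor `τ n → ∞`, so any constant
  -- such as `128/η²` is eventually available.
  have hsq : n * linkProb τ n ^ 2 = τ n * Real.log n := by
    rw [linkProb, Real.sq_sqrt (by positivity)]
    field_simp
  have hp0 : 0 ≤ linkProb τ n := Real.sqrt_nonneg _
  refine ⟨h1, h2, h3, h4, ?_, ?_⟩
  · have e1 : 8 ≤ τ n * η := (div_le_iff₀ hη).1 h6
    have e2 : τ n ≤ n * linkProb τ n := by
      calc τ n ≤ τ n * Real.log n := le_mul_of_one_le_right hτ0.le h7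
        _ = n * linkProb τ n ^ 2 := hsq.symm
        _ ≤ n * linkProb τ n := by
          gcongr
          nlinarith
    nlinarith
  · rw [hsq]
    have e1 : 128 ≤ τ n * η ^ 2 := (div_le_iff₀ (by positivity)).1 h5
    nlinarith

theorem ae_eventually_succeeds (Z : Link → Ω → ℝ) (hZm : ∀ q, Measurable (Z q))
    (hZu : ∀ q, pdf.IsUniform (Z q) (Set.Icc 0 1) μ volume) (hZi : iIndepFun Z μ)
    (hτ : Tendsto τ atTop atTop) (hp : Tendsto (linkProb τ) atTop (𝓝 0))
    (coin : ℕ → Link → Ω → Bool) (hcm : ∀ n q, Measurable (coin n q))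
    (hc : ∀ n q, μ {ω | coin n q ω = true} = 1 / 2) (hci : ∀ n, iIndepFun (coin n) μ)
    (hZc : ∀ n, IndepFun (fun ω q => Z q ω) (fun ω q => coin n q ω) μ) {ε : ℝ} (hε : 0 < ε) :
    ∀ᵐ ω ∂μ, ∀ᶠ n : ℕ in atTop,
      AllcastSucceeds (fun q => Z q ω) (fun q => coin n q ω) (linkProb τ n) n
        ⌈n * linkProb τ n * (1 - ε) / 2⌉₊ ∧
      allcastRate (fun q => Z q ω) (linkProb τ n) n ≤ n * linkProb τ n * (1 + ε) / 2 := by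
  -- The estimates need `η ≤ 1`; for `ε ≥ 1` the number of bits is `0` anyway.
  set η := min ε 1 with hη
  have hη0 : 0 < η := lt_min hε zero_lt_one
  have key := ae_eventually_notMem_of_le (μ := μ) (C := 9) (s := fun n =>
    {ω | ¬ (AllcastSucceeds (fun q => Z q ω) (fun q => coin n q ω) (linkProb τ n) n
        ⌈n * linkProb τ n * (1 - ε) / 2⌉₊ ∧
      allcastRate (fun q => Z q ω) (linkProb τ n) n ≤ n * linkProb τ n * (1 + η) / 2)}) (by
    filter_upwards [eventually_linkProb hτ hp hη0] with n ⟨h1, h2, h3, h4, h5, h6⟩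
    have hp0 : 0 ≤ linkProb τ n := Real.sqrt_nonneg _
    refine prob_failure_le (isRandomConfig_config hZm hZu hZi (hcm n) (hc n) (hci n) (hZc n)
      hp0 h4) hη0 (min_le_right _ _) h1 h2 h3 h5 h6 ?_
    have e1 : 0 ≤ n * linkProb τ n := by positivity
    have e2 : 0 ≤ n * linkProb τ n * (1 - η) / 2 := by
      have : 0 ≤ 1 - η := by linarith [min_le_right ε 1]
      positivity
    have e3 : ⌈n * linkProb τ n * (1 - ε) / 2⌉₊ ≤ ⌈n * linkProb τ n * (1 - η) / 2⌉₊ := by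
      rcases le_total ε 1 with h | h
      · rw [hη, min_eq_left h]
      · have : n * linkProb τ n * (1 - ε) / 2 ≤ 0 := by nlinarith
        rw [Nat.ceil_eq_zero.2 this]
        exact Nat.zero_le _
    have e4 : (⌈n * linkProb τ n * (1 - ε) / 2⌉₊ : ℝ) ≤ (⌈n * linkProb τ n * (1 - η) / 2⌉₊ : ℝ) := by
      exact_mod_cast e3
    exact e4.trans (Nat.ceil_lt_add_one e2).le)
  filter_upwards [key] with ω hω
  filter_upwards [hω] with n hn
  simp only [not_not] at hn
  refine ⟨hn.1, hn.2.trans ?_⟩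
  have hp0 : 0 ≤ linkProb τ n := Real.sqrt_nonneg _
  gcongr
  exact min_le_left _ _

/-- The law of independent fair coins. -/
noncomputable def coinLaw : Measure (Link → Bool) :=
  Measure.infinitePi fun _ => (PMF.uniformOfFintype Bool).toMeasure

instance : IsProbabilityMeasure coinLaw := by unfold coinLaw; infer_instance

theorem coinLaw_apply (q : Link) : coinLaw {c | c q = true} = 1 / 2 := by
  have h1 : {c : Link → Bool | c q = true} = (fun c => c q) ⁻¹' {true} := rfl
  rw [h1, ← Measure.map_apply (measurable_pi_apply q) MeasurableSet.of_discrete, coinLaw,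
    Measure.infinitePi_map_eval, PMF.toMeasure_apply_singleton _ _ MeasurableSet.of_discrete]
  simp

/-- `Ω` need not carry any coins, so independent fair ones are adjoined by a product with `coinLaw`,
the same for all `n`. -/
theorem ae_eventually_allcastRate (Z : Link → Ω → ℝ) (hZm : ∀ q, Measurable (Z q))
    (hZu : ∀ q, pdf.IsUniform (Z q) (Set.Icc 0 1) μ volume) (hZi : iIndepFun Z μ)
    (hτ : Tendsto τ atTop atTop) (hp : Tendsto (linkProb τ) atTop (𝓝 0)) {ε : ℝ} (hε : 0 < ε) :
    ∀ᵐ ω ∂μ, ∀ᶠ n : ℕ in atTop,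
      n * linkProb τ n * (1 - ε) / 2 ≤ allcastRate (fun q => Z q ω) (linkProb τ n) n ∧
      allcastRate (fun q => Z q ω) (linkProb τ n) n ≤ n * linkProb τ n * (1 + ε) / 2 := by
  have hfst : MeasurePreserving (Prod.fst : Ω × (Link → Bool) → Ω) (μ.prod coinLaw) μ :=
    measurePreserving_fst
  have hsnd : MeasurePreserving (Prod.snd : Ω × (Link → Bool) → (Link → Bool))
    (μ.prod coinLaw) coinLaw := measurePreserving_snd
  have hmap : ∀ q, (μ.prod coinLaw).map (fun x => Z q x.1) = μ.map (Z q) := fun q =>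
    (Measure.map_map (hZm q) measurable_fst).symm.trans (by rw [hfst.map_eq])
  have hZpi : Measurable fun ω q => Z q ω := measurable_pi_lambda _ hZm
  have hi1 := iIndepFun_comp_measurePreserving hZm hZi hfst
  have hi2 := iIndepFun_comp_measurePreserving measurable_pi_apply
    (iIndepFun_infinitePi (P := fun _ : Link => (PMF.uniformOfFintype Bool).toMeasure)
      (X := fun _ b => b) fun _ => measurable_id) hsnd
  have hcm : ∀ q, Measurable fun x : Ω × (Link → Bool) => x.2 q := fun q =>
    (measurable_pi_apply q).comp measurable_snd
  have hcoin : ∀ q, μ.prod coinLaw {x | x.2 q = true} = 1 / 2 := fun q => by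
    have h : MeasurableSet {c : Link → Bool | c q = true} :=
      measurableSet_eq_fun (measurable_pi_apply q) measurable_const
    rw [← coinLaw_apply q, ← hsnd.measure_preimage h.nullMeasurableSet]
    rfl
  have key := ae_eventually_succeeds (μ := μ.prod coinLaw) (τ := τ) (fun q x => Z q x.1)
    (fun q => (hZm q).comp measurable_fst)
    (fun q => by rw [pdf.IsUniform, hmap q]; exact hZu q) hi1 hτ hp
    (fun _ q x => x.2 q) (fun _ => hcm)
    (fun _ => hcoin)
    (fun _ => hi2) (fun _ => (indepFun_prod hZpi measurable_id)) hε
  -- By Fubini, for almost every `ω` some choice of coins works; the rate does not depend on them.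
  filter_upwards [Measure.ae_ae_of_ae_prod key] with ω hω
  obtain ⟨c, hc⟩ := hω.exists
  filter_upwards [hc, eventually_ge_atTop 2] with n hn h2
  exact ⟨(Nat.le_ceil _).trans (le_allcastRate_of_succeeds h2 hn.1), hn.2⟩

theorem ae_tendsto_allcastRate (Z : Link → Ω → ℝ) (hZm : ∀ q, Measurable (Z q))
    (hZu : ∀ q, pdf.IsUniform (Z q) (Set.Icc 0 1) μ volume) (hZi : iIndepFun Z μ)
    (hτ : Tendsto τ atTop atTop) (hp : Tendsto (linkProb τ) atTop (𝓝 0)) :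
    ∀ᵐ ω ∂μ, Tendsto (fun n : ℕ => allcastRate (fun q => Z q ω) (linkProb τ n) n /
      (n * linkProb τ n)) atTop (𝓝 (1 / 2)) := by
  -- Countably many tolerances `1/(k + 1)` give a single null set.
  have key : ∀ᵐ ω ∂μ, ∀ k : ℕ, ∀ᶠ n : ℕ in atTop,
      n * linkProb τ n * (1 - 1 / ((k : ℝ) + 1)) / 2 ≤
        allcastRate (fun q => Z q ω) (linkProb τ n) n ∧
      allcastRate (fun q => Z q ω) (linkProb τ n) n ≤
        n * linkProb τ n * (1 + 1 / ((k : ℝ) + 1)) / 2 :=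
    ae_all_iff.2 fun k => ae_eventually_allcastRate Z hZm hZu hZi hτ hp (by positivity)
  filter_upwards [key] with ω hω
  rw [Metric.tendsto_nhds]
  intro ε hε
  obtain ⟨k, hk⟩ := exists_nat_one_div_lt hε
  filter_upwards [hω k, eventually_linkProb hτ hp zero_lt_one] with n ⟨h1, h2⟩ h3
  have hpos : 0 < n * linkProb τ n := by linarith [h3.2.2.2.2.1]
  have hk0 : 0 < 1 / ((k : ℝ) + 1) := by positivity
  rw [Real.dist_eq, abs_lt]
  have h4 : (1 - 1 / ((k : ℝ) + 1)) / 2 ≤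
      allcastRate (fun q => Z q ω) (linkProb τ n) n / (n * linkProb τ n) := by
    rw [le_div_iff₀ hpos]; linarith
  have h5 : allcastRate (fun q => Z q ω) (linkProb τ n) n / (n * linkProb τ n) ≤
      (1 + 1 / ((k : ℝ) + 1)) / 2 := by
    rw [div_le_iff₀ hpos]; linarith
  constructor <;> linarith

end Limit

end Allcast

theorem mainTheorem4 {Ω : Type*} [MeasurableSpace Ω] (μ : Measure Ω) [IsProbabilityMeasure μ]
    -- the independent uniform variables that define all the graphs
    (Z : Allcast.Link → Ω → ℝ) (hZm : ∀ q, Measurable (Z q))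
    (hZu : ∀ q, pdf.IsUniform (Z q) (Set.Icc 0 1) μ volume) (hZi : iIndepFun Z μ)
    (τ : ℕ → ℝ) (hτ : Tendsto τ atTop atTop)
    (hp : Tendsto (Allcast.linkProb τ) atTop (𝓝 0)) :
    -- for each `n`, independent fair coins for the directions, independent of the graphs
    (∀ coin : ℕ → Allcast.Link → Ω → Bool,
      (∀ n q, Measurable (coin n q)) →
      (∀ n q, μ {ω | coin n q ω = true} = 1 / 2) →
      (∀ n, iIndepFun (coin n) μ) →
      (∀ n, IndepFun (fun ω q => Z q ω) (fun ω q => coin n q ω) μ) →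
      ∀ ε : ℝ, 0 < ε →
        ∀ᵐ ω ∂μ, ∀ᶠ n : ℕ in atTop,
          Allcast.AllcastSucceeds (fun q => Z q ω) (fun q => coin n q ω) (Allcast.linkProb τ n) n
            ⌈n * Allcast.linkProb τ n * (1 - ε) / 2⌉₊) ∧
    ∀ᵐ ω ∂μ, Tendsto (fun n : ℕ =>
        Allcast.allcastRate (fun q => Z q ω) (Allcast.linkProb τ n) n /
          (n * Allcast.linkProb τ n)) atTop (𝓝 (1 / 2)) := by
  refine ⟨fun coin hcm hc hci hZc ε hε => ?_,
    Allcast.ae_tendsto_allcastRate Z hZm hZu hZi hτ hp⟩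
  filter_upwards [Allcast.ae_eventually_succeeds Z hZm hZu hZi hτ hp coin hcm hc hci hZc hε]
    with ω hω
  exact hω.mono fun n hn => hn.1
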